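/- **Setting.** Let $U\subset\mathbb R^m$, $G,G_1\subseteq\mathbb R^n$, and let $\mathcal U=L^\infty_{\rm loc}([0,+\infty),U)$ be the class of measurable, locally essentially bounded functions $u:[0,+\infty)\to U$. Consider the control system $\dot x(t)=f(x(t),u(t))$, $x(0)=x_0\in G$, $u\in\mathcal U$, with solutions understood in the sense of Carathéodory (locally absolutely continuous, satisfying the equation almost everywhere). Balls and norms are Euclidean, $\mathrm B_r(\xi)$ denotes the open ball, and an open domain is a nonempty connected open set. A real function on a set is *proper* if preimages of compact sets are compact, and *positive definite* if it vanishes at $0$ and is positive at all other points of its domain. The lower Dini derivative is $\partial^-\varphi(x;v)=\liminf_{h\to0+,\,w\to v}\frac{\varphi(x+hw)-\varphi(x)}{h}\in[-\infty,+\infty]$. **Assumptions on the system.** 1. $U$ is compact, $G,G_1$ are open domains, $\bar G\subseteq G_1$, $0\in G$. 2. $f:G_1\times U\to\mathbb R^n$ is continuous. 3. For every $T\in(0,+\infty]$, $x_0\in G$ and $u\in\mathcal U$, every $G_1$-valued solution of the system on $[0,T)$ stays in $G$. 4. For every $R>0$ there is $C_{1,R}>0$ with $\|f(x,u)-f(x',u)\|\le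 C_{1,R}\|x-x'\|$ for all $x,x'\in\bar{\mathrm B}_R(0)\cap\bar G$ and all $u\in U$. 5. There are a continuously differentiable proper function $Y:G_1\to[0,+\infty)$ and $C_2>0$ with $\langle \mathrm DY(x),f(x,u)\rangle\le C_2Y(x)$ for all $x\in G_1$, $u\in U$. 6. The set $\{f(x,u):u\in U\}$ is convex for every $x\in\bar G$. **Assumptions on the local control Lyapunov function.** 1. $\Omega\subseteq G$ is an open domain with $0\in\Omega$. 2. $V_{\rm loc}:\bar\Omega\to[0,+\infty)$ is continuous, proper and positive definite, and there is a continuous positive definite function $W_{\rm loc}:\Omega\to[0,+\infty)$ with $\inf_{u\in U}\partial^-V_{\rm loc}(x;f(x,u))\le -W_{\rm loc}(x)$ for all $x\in\Omega$. 3. $V_{\rm loc}$ is locally Lipschitz continuous in $\Omega$. 4. $c>0$ is such that $\{x\in\bar\Omega:V_{\rm loc}(x)<c\}$ is an open domain in $\mathbb R^n$ whose closure is $\Omega_c=\{x\in\bar\Omega:V_{\rm loc}(x)\le c\}$, that $\Omega_c+\mathrm B_{C_3}(0)\subseteq\Omega$ for some $C_3>0$, and that $\partial\Omega_c=\{x\in\bar\Omega:V_{\rm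 loc}(x)=c\}$. 5. $\lim_{\varepsilon\to+0}\sup\{\|x\|:x\in\bar\Omega,\ V_{\rm loc}(x)\le\varepsilon\}=0$. Let $\mathcal D_0$ be the set of all $x_0\in G$ for which there is $u\in\mathcal U$ such that the solution $x(t;x_0,u)\in G$ exists for all $t\ge0$ and $\lim_{t\to+\infty}\|x(t;x_0,u)\|=0$. **Proposition.** Under these assumptions, $\mathcal D_0$ is an open domain (a nonempty open connected set) containing $\Omega_c$, and it is weakly invariant: for every $x_0\in\mathcal D_0$ there is $u\in\mathcal U$ such that the solution $x(t;x_0,u)$ exists for all $t\ge0$ and $x(t;x_0,u)\in\mathcal D_0$ for all $t\ge0$. -/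

import Mathlib

open Set Filter Topology MeasureTheory
open scoped Pointwise ENNReal

/-- The class of admissible controls `L^∞_loc([0, +∞), U)`: measurable, essentially bounded on
every bounded time interval, with values in `U`. (Only the values at times `t ≥ 0` matter.) -/
def AdmissibleControls {m : ℕ} (U : Set (EuclideanSpace ℝ (Fin m))) :
    Set (ℝ → EuclideanSpace ℝ (Fin m)) :=
  {u | (∀ T : ℝ, 0 < T → MemLp u ∞ (volume.restrict (Icc 0 T))) ∧ ∀ t : ℝ, 0 ≤ t → u t ∈ U}

/-- `x` is a Carathéodory solution of `x' = f (x, u)`, `x 0 = x₀`, on the time interval `[0, T)`,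
`T ∈ (0, +∞]`, with values in `S`. It is written as the integral equation, which says exactly that
`x` is locally absolutely continuous on `[0, T)`, starts at `x₀` and satisfies the differential
equation almost everywhere. Values of `x` outside `[0, T)` play no role. -/
def IsTrajectory {n m : ℕ}
    (f : EuclideanSpace ℝ (Fin n) → EuclideanSpace ℝ (Fin m) → EuclideanSpace ℝ (Fin n))
    (S : Set (EuclideanSpace ℝ (Fin n))) (T : EReal) (x₀ : EuclideanSpace ℝ (Fin n))
    (u : ℝ → EuclideanSpace ℝ (Fin m)) (x : ℝ → EuclideanSpace ℝ (Fin n)) : Prop :=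
  ∀ t : ℝ, 0 ≤ t → (t : EReal) < T →
    x t ∈ S ∧
    IntervalIntegrable (fun s => f (x s) (u s)) volume 0 t ∧
    x t = x₀ + ∫ s in (0 : ℝ)..t, f (x s) (u s)

/-- The global region of asymptotic null-controllability `𝒟₀`. -/
def nullControllabilityRegion {n m : ℕ} (U : Set (EuclideanSpace ℝ (Fin m)))
    (G : Set (EuclideanSpace ℝ (Fin n)))
    (f : EuclideanSpace ℝ (Fin n) → EuclideanSpace ℝ (Fin m) → EuclideanSpace ℝ (Fin n)) :
    Set (EuclideanSpace ℝ (Fin n)) :=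
  {x₀ | x₀ ∈ G ∧ ∃ u ∈ AdmissibleControls U, ∃ x : ℝ → EuclideanSpace ℝ (Fin n),
    IsTrajectory f G ⊤ x₀ u x ∧ Tendsto (fun t => ‖x t‖) atTop (𝓝 0)}

/-- A real function on `S` is proper if preimages (in `S`) of compact sets are compact. -/
def IsProperFunOn {n : ℕ} (φ : EuclideanSpace ℝ (Fin n) → ℝ)
    (S : Set (EuclideanSpace ℝ (Fin n))) : Prop :=
  ∀ M : Set ℝ, IsCompact M → IsCompact (S ∩ φ ⁻¹' M)

/-- Positive definiteness on a set `S` containing the origin. -/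
def IsPosDefOn {n : ℕ} (φ : EuclideanSpace ℝ (Fin n) → ℝ)
    (S : Set (EuclideanSpace ℝ (Fin n))) : Prop :=
  φ 0 = 0 ∧ ∀ x ∈ S, x ≠ 0 → 0 < φ x

/-- The lower Dini derivative (directional subderivate)
`liminf_{h → 0+, w → v} (φ (x + h w) - φ x) / h`, an extended real number. -/
noncomputable def lowerDini {n : ℕ} (φ : EuclideanSpace ℝ (Fin n) → ℝ)
    (x v : EuclideanSpace ℝ (Fin n)) : EReal :=
  liminf (fun p : ℝ × EuclideanSpace ℝ (Fin n) =>
    (((φ (x + p.1 • p.2) - φ x) / p.1 : ℝ) : EReal)) (𝓝[>] (0 : ℝ) ×ˢ 𝓝 v)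

/-- The standing conditions on the control system. -/
structure SystemConditions {n m : ℕ} (U : Set (EuclideanSpace ℝ (Fin m)))
    (G G₁ : Set (EuclideanSpace ℝ (Fin n)))
    (f : EuclideanSpace ℝ (Fin n) → EuclideanSpace ℝ (Fin m) → EuclideanSpace ℝ (Fin n)) :
    Prop where
  compact_U : IsCompact U
  open_G : IsOpen G
  connected_G : IsConnected G
  open_G₁ : IsOpen G₁
  connected_G₁ : IsConnected G₁
  closure_G_subset : closure G ⊆ G₁
  zero_mem : (0 : EuclideanSpace ℝ (Fin n)) ∈ G
  continuous_f : ContinuousOn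
    (fun p : EuclideanSpace ℝ (Fin n) × EuclideanSpace ℝ (Fin m) => f p.1 p.2) (G₁ ×ˢ U)
  /-- Strong invariance of `G`. -/
  strongly_invariant : ∀ T : EReal, 0 < T → ∀ x₀ ∈ G, ∀ u ∈ AdmissibleControls U,
    ∀ x : ℝ → EuclideanSpace ℝ (Fin n), IsTrajectory f G₁ T x₀ u x →
      ∀ t : ℝ, 0 ≤ t → (t : EReal) < T → x t ∈ G
  lipschitz_f : ∀ R : ℝ, 0 < R → ∃ C : ℝ, 0 < C ∧
    ∀ x ∈ Metric.closedBall 0 R ∩ closure G, ∀ x' ∈ Metric.closedBall 0 R ∩ closure G,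
      ∀ u ∈ U, ‖f x u - f x' u‖ ≤ C * ‖x - x'‖
  growth : ∃ Y : EuclideanSpace ℝ (Fin n) → ℝ, ∃ C₂ : ℝ, 0 < C₂ ∧
    ContDiffOn ℝ 1 Y G₁ ∧ (∀ x ∈ G₁, 0 ≤ Y x) ∧ IsProperFunOn Y G₁ ∧
    ∀ x ∈ G₁, ∀ u ∈ U, fderiv ℝ Y x (f x u) ≤ C₂ * Y x

/-- `V` is a local control Lyapunov function on `closure Ω` and `c` is an admissible level.
Only the values of `V` on `closure Ω` matter: `Ω` is open, so the lower Dini derivatives at points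
of `Ω` depend only on `V` restricted to `Ω`. -/
structure LocalCLFConditions {n m : ℕ} (U : Set (EuclideanSpace ℝ (Fin m)))
    (G : Set (EuclideanSpace ℝ (Fin n)))
    (f : EuclideanSpace ℝ (Fin n) → EuclideanSpace ℝ (Fin m) → EuclideanSpace ℝ (Fin n))
    (Ω : Set (EuclideanSpace ℝ (Fin n))) (V : EuclideanSpace ℝ (Fin n) → ℝ) (c : ℝ) :
    Prop where
  open_Ω : IsOpen Ω
  connected_Ω : IsConnected Ω
  Ω_subset : Ω ⊆ G
  zero_mem : (0 : EuclideanSpace ℝ (Fin n)) ∈ Ω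
  continuous_V : ContinuousOn V (closure Ω)
  proper_V : IsProperFunOn V (closure Ω)
  posDef_V : IsPosDefOn V (closure Ω)
  /-- The infinitesimal decrease condition. -/
  decrease : ∃ W : EuclideanSpace ℝ (Fin n) → ℝ, ContinuousOn W Ω ∧ IsPosDefOn W Ω ∧
    ∀ x ∈ Ω, (⨅ u ∈ U, lowerDini V x (f x u)) ≤ ((-W x : ℝ) : EReal)
  locallyLipschitz_V : LocallyLipschitzOn Ω V
  c_pos : 0 < c
  open_sublevel : IsOpen {x ∈ closure Ω | V x < c}
  connected_sublevel : IsConnected {x ∈ closure Ω | V x < c}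
  closure_sublevel : closure {x ∈ closure Ω | V x < c} = {x ∈ closure Ω | V x ≤ c}
  sublevel_add_ball : ∃ C₃ : ℝ, 0 < C₃ ∧
    {x ∈ closure Ω | V x ≤ c} + Metric.ball (0 : EuclideanSpace ℝ (Fin n)) C₃ ⊆ Ω
  frontier_sublevel : frontier {x ∈ closure Ω | V x ≤ c} = {x ∈ closure Ω | V x = c}
  sublevel_shrink : Tendsto (fun ε : ℝ => ⨆ x ∈ {x ∈ closure Ω | V x ≤ ε}, ‖x‖ₑ)
    (𝓝[>] 0) (𝓝 0)

/-!
By the Dini condition and the local Lipschitz continuity of `V`, some constant control makes `V`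
drop strictly along a short trajectory starting at any given nonzero point of `Ω`. Trajectories
depend continuously on the initial point, so the infimum of `V` over the points reached from
`p ∈ Ω_c` can be attained on the closure of this set only at the origin: `V` can be made as small
as desired. Halving the level of `V` again and again, and spending at least unit time on each level,
one obtains countably many arcs whose concatenation tends to the origin; hence `Ω_c ⊆ 𝒟₀`, and `𝒟₀`
is a neighbourhood of the origin.

A control that steers `p ∈ 𝒟₀` into this neighbourhood also steers all points near `p` into it, so
`𝒟₀` is open. Trajectories that tend to the origin stay in `𝒟₀` and end up in a ball around the
origin contained in `𝒟₀`, which gives weak invariance and connectedness.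

The growth condition on `Y` bounds trajectories on finite time intervals. Existence is
Carathéodory's theorem, obtained as a limit of Euler polygons.
-/

section Trajectories

variable {E A B : Type*} [NormedAddCommGroup E] [NormedSpace ℝ E]
  {f : E → A → E} {g : E → B → E} {S S' : Set E} {I J : Set ℝ} {p : E} {u : ℝ → A} {v : ℝ → B}
  {x : ℝ → E} {M T : ℝ}

/-- The integral equation of `IsTrajectory` on an arbitrary set `I` of times, for controls with
values in an arbitrary type `A`. -/
def IsTrajectoryOn (f : E → A → E) (S : Set E) (I : Set ℝ) (p : E) (u : ℝ → A) (x : ℝ → E) :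
    Prop :=
  ∀ t ∈ I, x t ∈ S ∧ IntervalIntegrable (fun s => f (x s) (u s)) volume 0 t ∧
    x t = p + ∫ s in (0 : ℝ)..t, f (x s) (u s)

theorem IsTrajectoryOn.mono (h : IsTrajectoryOn f S I p u x) (hJ : J ⊆ I)
    (hS : ∀ t ∈ J, x t ∈ S') : IsTrajectoryOn f S' J p u x :=
  fun t ht => ⟨hS t ht, (h t (hJ ht)).2⟩

theorem IsTrajectoryOn.apply_zero (h : IsTrajectoryOn f S I p u x) (h0 : 0 ∈ I) : x 0 = p := by
  simpa only [intervalIntegral.integral_same, add_zero] using (h 0 h0).2.2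

theorem IsTrajectoryOn.continuousOn (h : IsTrajectoryOn f S (Icc 0 T) p u x) :
    ContinuousOn x (Icc 0 T) := by
  rcases lt_or_ge T 0 with hT | hT
  · simp only [Icc_eq_empty hT.not_ge, continuousOn_empty]
  have hprim := intervalIntegral.continuousOn_primitive_interval'
    (h T (right_mem_Icc.2 hT)).2.1 left_mem_uIcc
  rw [uIcc_of_le hT] at hprim
  exact (continuousOn_const.add hprim).congr fun t ht => (h t ht).2.2

theorem IsTrajectoryOn.congr_ae (h : IsTrajectoryOn f S I p u x)
    (hfg : ∀ᵐ s, ∀ t ∈ I, s ∈ uIoc 0 t → f (x s) (u s) = g (x s) (v s)) :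
    IsTrajectoryOn g S I p v x := by
  intro t ht
  have hae : ∀ᵐ s, s ∈ uIoc 0 t → f (x s) (u s) = g (x s) (v s) :=
    hfg.mono fun s hs => hs t ht
  obtain ⟨hS, hint, hx⟩ := h t ht
  exact ⟨hS, hint.congr_ae ((ae_restrict_iff' measurableSet_uIoc).2 hae),
    hx.trans (by rw [intervalIntegral.integral_congr_ae hae])⟩

theorem IsTrajectoryOn.norm_sub_le (h : IsTrajectoryOn f S (Icc 0 T) p u x)
    (hM : ∀ z ∈ S, ∀ w, ‖f z w‖ ≤ M) {s t : ℝ} (hs : s ∈ Icc 0 T) (ht : t ∈ Icc 0 T) :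
    ‖x t - x s‖ ≤ M * |t - s| := by
  rw [(h t ht).2.2, (h s hs).2.2, add_sub_add_left_eq_sub,
    intervalIntegral.integral_interval_sub_left (h t ht).2.1 (h s hs).2.1]
  exact intervalIntegral.norm_integral_le_of_norm_le_const fun r hr =>
    hM _ (h r (uIcc_subset_Icc hs ht (uIoc_subset_uIcc hr))).1 _

theorem IsTrajectoryOn.ae_hasDerivAt [CompleteSpace E]
    (h : IsTrajectoryOn f S (Icc 0 T) p u x) :
    ∀ᵐ t, t ∈ Ioo 0 T → HasDerivAt x (f (x t) (u t)) t := by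
  rcases lt_or_ge T 0 with hT | hT
  · exact ae_of_all _ fun t ht => absurd (ht.1.trans ht.2) hT.not_gt
  filter_upwards [(h T (right_mem_Icc.2 hT)).2.1.ae_hasDerivAt_integral] with t ht htT
  rw [uIcc_of_le hT] at ht
  refine ((ht (Ioo_subset_Icc_self htT) 0 (left_mem_Icc.2 hT)).const_add p).congr_of_eventuallyEq ?_
  filter_upwards [Ioo_mem_nhds htT.1 htT.2] with s hs
  exact (h s (Ioo_subset_Icc_self hs)).2.2

end Trajectories

section Peano

variable {E A : Type*} [NormedAddCommGroup E] [NormedSpace ℝ E]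
  {F : E → A → E} {M : ℝ} {u : ℝ → A} {x₀ : E} {τ T : ℝ}

theorem norm_primitive_sub_le {g : ℝ → E} (hg : AEStronglyMeasurable g) (hM : ∀ s, ‖g s‖ ≤ M)
    (x₀ : E) (a b : ℝ) :
    ‖(x₀ + ∫ s in (0 : ℝ)..a, g s) - (x₀ + ∫ s in (0 : ℝ)..b, g s)‖ ≤ M * |a - b| := by
  have hint (c d : ℝ) : IntervalIntegrable g volume c d :=
    (intervalIntegrable_const (c := M)).mono_fun hg.restrict
      (ae_of_all _ fun s => (hM s).trans (le_abs_self M))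
  rw [add_sub_add_left_eq_sub,
    intervalIntegral.integral_interval_sub_left (hint _ _) (hint _ _)]
  exact intervalIntegral.norm_integral_le_of_norm_le_const fun s _ => hM s

/-- Nodes of the Euler polygon with step `τ` for `x' = F (x, u)`, `x 0 = x₀`. Only the state is
frozen on each step; the control keeps varying, since it is merely measurable. -/
noncomputable def eulerNode (F : E → A → E) (u : ℝ → A) (x₀ : E) (τ : ℝ) : ℕ → E
  | 0 => x₀
  | j + 1 => eulerNode F u x₀ τ j +
      ∫ s in (j * τ)..((j + 1 : ℕ) * τ), F (eulerNode F u x₀ τ j) (u s)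

/-- The step function through the nodes of the Euler polygon with step `τ`. -/
noncomputable def eulerStep (F : E → A → E) (u : ℝ → A) (x₀ : E) (τ : ℝ) (s : ℝ) : E :=
  eulerNode F u x₀ τ ⌊s / τ⌋₊

theorem eulerStep_eq_eulerNode (hτ : 0 < τ) {j : ℕ} {s : ℝ}
    (hs : s ∈ Ico (j * τ) ((j + 1 : ℕ) * τ)) : eulerStep F u x₀ τ s = eulerNode F u x₀ τ j := by
  have hs0 : 0 ≤ s := (by positivity : (0 : ℝ) ≤ j * τ).trans hs.1
  rw [eulerStep, (Nat.floor_eq_iff (div_nonneg hs0 hτ.le)).2]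
  rw [le_div_iff₀ hτ, div_lt_iff₀ hτ]
  exact_mod_cast hs

variable [FiniteDimensional ℝ E]

theorem exists_tendsto_subseq_of_dist_le {X : ℕ → ℝ → E} (hT : 0 ≤ T)
    (hX0 : ∀ k, X k 0 = x₀) (hX : ∀ k a b, dist (X k a) (X k b) ≤ M * dist a b) :
    ∃ x : ℝ → E, Continuous x ∧ ∃ σ : ℕ → ℕ, StrictMono σ ∧
      ∀ t ∈ Icc 0 T, Tendsto (fun k => X (σ k) t) atTop (𝓝 (x t)) := by
  have hcont (k : ℕ) : Continuous (X k) :=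
    (LipschitzWith.of_dist_le' (K := M) fun a b => hX k a b).continuous
  let Φ (k : ℕ) : BoundedContinuousFunction (Icc 0 T) E :=
    BoundedContinuousFunction.mkOfCompact ⟨fun t => X k t, (hcont k).comp continuous_subtype_val⟩
  have hcpt : IsCompact (closure (range Φ)) := by
    refine BoundedContinuousFunction.arzela_ascoli (Metric.closedBall x₀ (|M| * T))
      (isCompact_closedBall _ _) _ ?_ ?_
    · rintro _ t ⟨k, rfl⟩
      calc dist (X k t) x₀ ≤ M * dist (t : ℝ) 0 := hX0 k ▸ hX k t 0
        _ ≤ |M| * T := by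
          rw [Real.dist_0_eq_abs, abs_of_nonneg t.2.1]
          exact mul_le_mul (le_abs_self M) t.2.2 t.2.1 (abs_nonneg M)
    · refine Metric.equicontinuous_of_continuity_modulus (fun d => M * d) ?_ _ ?_
      · simpa only [mul_zero] using (continuous_const_mul M).tendsto 0
      · rintro a b ⟨_, k, rfl⟩
        exact hX k a b
  obtain ⟨φ, -, σ, hσ, hlim⟩ := hcpt.tendsto_subseq fun k => subset_closure (mem_range_self k)
  refine ⟨fun t => φ (projIcc 0 T hT t), φ.continuous.comp continuous_projIcc, σ, hσ,
    fun t ht => ?_⟩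
  simp only [projIcc_of_mem hT ht]
  exact (BoundedContinuousFunction.tendsto_iff_tendstoUniformly.1 hlim).tendsto_at ⟨t, ht⟩

variable [MeasurableSpace E] [BorelSpace E] [TopologicalSpace A]
  [MeasurableSpace A] [OpensMeasurableSpace A]

theorem measurable_velocity_eulerStep (hF : Continuous (Function.uncurry F)) (hu : Measurable u) :
    Measurable fun s => F (eulerStep F u x₀ τ s) (u s) := by
  have hstep : Measurable (eulerStep F u x₀ τ) :=
    measurable_from_nat.comp (Nat.measurable_floor.comp (measurable_id.div_const τ))
  exact hF.measurable.comp (hstep.prodMk hu)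

/-- The Euler polygon with step `τ`, as the primitive of its velocity. -/
noncomputable def eulerPolygon (F : E → A → E) (u : ℝ → A) (x₀ : E) (τ t : ℝ) : E :=
  x₀ + ∫ s in (0 : ℝ)..t, F (eulerStep F u x₀ τ s) (u s)

theorem dist_eulerPolygon_le (hF : Continuous (Function.uncurry F)) (hM : ∀ z w, ‖F z w‖ ≤ M)
    (hu : Measurable u) (a b : ℝ) :
    dist (eulerPolygon F u x₀ τ a) (eulerPolygon F u x₀ τ b) ≤ M * dist a b := by
  rw [dist_eq_norm, Real.dist_eq]
  exact norm_primitive_sub_le (measurable_velocity_eulerStep hF hu).aestronglyMeasurable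
    (fun s => hM _ _) x₀ a b

theorem eulerPolygon_node (hF : Continuous (Function.uncurry F)) (hM : ∀ z w, ‖F z w‖ ≤ M)
    (hu : Measurable u) (hτ : 0 < τ) (j : ℕ) :
    eulerPolygon F u x₀ τ (j * τ) = eulerNode F u x₀ τ j := by
  have hint (a b : ℝ) : IntervalIntegrable (fun s => F (eulerStep F u x₀ τ s) (u s)) volume a b :=
    (intervalIntegrable_const (c := M)).mono_fun
      (measurable_velocity_eulerStep hF hu).aestronglyMeasurable
      (ae_of_all _ fun s => (hM _ _).trans (le_abs_self M))
  induction j with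
  | zero => simp [eulerPolygon, eulerNode]
  | succ j ih =>
    have hle : (j : ℝ) * τ ≤ (j + 1 : ℕ) * τ := by gcongr; exact j.le_succ
    have hstep : ∫ s in (j * τ)..((j + 1 : ℕ) * τ), F (eulerStep F u x₀ τ s) (u s) =
        ∫ s in (j * τ)..((j + 1 : ℕ) * τ), F (eulerNode F u x₀ τ j) (u s) :=
      intervalIntegral.integral_congr_Ioo_of_le hle fun s hs => by
        simp only [eulerStep_eq_eulerNode hτ (Ioo_subset_Ico_self hs)]
    rw [eulerPolygon,
      ← intervalIntegral.integral_add_adjacent_intervals (hint 0 (j * τ)) (hint _ _),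
      ← add_assoc, ← eulerPolygon, ih, hstep, eulerNode]

theorem norm_eulerPolygon_sub_eulerStep_le (hF : Continuous (Function.uncurry F))
    (hM : ∀ z w, ‖F z w‖ ≤ M) (hu : Measurable u) (hτ : 0 < τ) {t : ℝ} (ht : 0 ≤ t) :
    ‖eulerPolygon F u x₀ τ t - eulerStep F u x₀ τ t‖ ≤ M * τ := by
  have hfloor : dist t (⌊t / τ⌋₊ * τ) ≤ τ := by
    have hle := (le_div_iff₀ hτ).1 (Nat.floor_le (div_nonneg ht hτ.le))
    have hlt := (div_lt_iff₀ hτ).1 (Nat.lt_floor_add_one (t / τ))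
    rw [Real.dist_eq, abs_le]
    constructor <;> linarith
  have hM0 : 0 ≤ M := (norm_nonneg _).trans (hM x₀ (u 0))
  rw [eulerStep, ← eulerPolygon_node hF hM hu hτ, ← dist_eq_norm]
  exact (dist_eulerPolygon_le hF hM hu _ _).trans (mul_le_mul_of_nonneg_left hfloor hM0)

theorem exists_isTrajectoryOn_of_bounded (hF : Continuous (Function.uncurry F))
    (hM : ∀ z w, ‖F z w‖ ≤ M) (hu : Measurable u) (x₀ : E) (hT : 0 ≤ T) :
    ∃ x : ℝ → E, IsTrajectoryOn F univ (Icc 0 T) x₀ u x := by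
  let τ (k : ℕ) : ℝ := 1 / (k + 1)
  have hτ (k : ℕ) : 0 < τ k := Nat.one_div_pos_of_nat
  have hmeas (k : ℕ) : Measurable fun s => F (eulerStep F u x₀ (τ k) s) (u s) :=
    measurable_velocity_eulerStep hF hu
  obtain ⟨x, hx, σ, hσ, hlim⟩ := exists_tendsto_subseq_of_dist_le (X := fun k =>
    eulerPolygon F u x₀ (τ k)) hT
    (fun k => show _ = x₀ by simp only [eulerPolygon, intervalIntegral.integral_same, add_zero])
    fun k => dist_eulerPolygon_le hF hM hu
  have hstep {s : ℝ} (hs : s ∈ Icc 0 T) :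
      Tendsto (fun k => eulerStep F u x₀ (τ (σ k)) s) atTop (𝓝 (x s)) := by
    have hgap : Tendsto (fun k => eulerPolygon F u x₀ (τ (σ k)) s -
        eulerStep F u x₀ (τ (σ k)) s) atTop (𝓝 0) := by
      refine squeeze_zero_norm (fun k =>
        norm_eulerPolygon_sub_eulerStep_le hF hM hu (hτ (σ k)) hs.1) ?_
      simpa only [mul_zero, Function.comp_def] using
        (tendsto_one_div_add_atTop_nhds_zero_nat.comp hσ.tendsto_atTop).const_mul M
    simpa only [sub_sub_cancel, sub_zero] using (hlim s hs).sub hgap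
  refine ⟨x, fun t ht => ⟨mem_univ _, ?_, tendsto_nhds_unique (hlim t ht) <|
    (intervalIntegral.tendsto_integral_filter_of_dominated_convergence (fun _ => M)
      (Eventually.of_forall fun k => (hmeas (σ k)).aestronglyMeasurable)
      (Eventually.of_forall fun k => ae_of_all _ fun s _ => hM _ _) intervalIntegrable_const
      (ae_of_all _ fun s hs => ?_)).const_add x₀⟩⟩
  · exact (intervalIntegrable_const (c := M)).mono_fun
      (hF.measurable.comp (hx.measurable.prodMk hu)).aestronglyMeasurable
      (ae_of_all _ fun s => (hM _ _).trans (le_abs_self M))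
  · have hsT : s ∈ Icc 0 T :=
      Icc_subset_Icc_right ht.2 (Ioc_subset_Icc_self (by rwa [uIoc_of_le ht.1] at hs))
    exact (hF.tendsto (x s, u s)).comp ((hstep hsT).prodMk_nhds tendsto_const_nhds)

end Peano

section Growth

theorem le_mul_exp_of_le_add_integral {φ : ℝ → ℝ} {a C T : ℝ} (hC : 0 ≤ C)
    (hφ : ContinuousOn φ (Icc 0 T)) (hle : ∀ t ∈ Icc 0 T, φ t ≤ a + ∫ s in (0 : ℝ)..t, C * φ s)
    {t : ℝ} (ht : t ∈ Icc 0 T) : φ t ≤ a * Real.exp (C * t) := by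
  have hT : 0 ≤ T := ht.1.trans ht.2
  let ψ : ℝ → ℝ := IccExtend hT ((Icc 0 T).domRestrict φ)
  have hψ : Continuous ψ := hφ.domRestrict.Icc_extend'
  have hψφ : EqOn ψ φ (Icc 0 T) := fun s hs => IccExtend_of_mem hT _ hs
  let g (s : ℝ) : ℝ := a + ∫ r in (0 : ℝ)..s, C * ψ r
  have hg (s : ℝ) : HasDerivAt g (C * ψ s) s :=
    ((hψ.const_mul C).integral_hasStrictDerivAt 0 s).hasDerivAt.const_add a
  have hφg (s : ℝ) (hs : s ∈ Icc 0 T) : φ s ≤ g s := by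
    refine (hle s hs).trans_eq (congrArg (a + ·) (intervalIntegral.integral_congr fun r hr => ?_))
    rw [uIcc_of_le hs.1] at hr
    simp only [hψφ (Icc_subset_Icc_right hs.2 hr)]
  have hgronwall := le_gronwallBound_of_liminf_deriv_right_le (δ := a) (K := C) (ε := 0)
    (fun s _ => (hg s).continuousAt.continuousWithinAt)
    (fun s _ r hr => (hg s).hasDerivWithinAt.liminf_right_slope_le hr) (by simp [g])
    (fun s hs => ?_) t ht
  · rw [gronwallBound_ε0, sub_zero] at hgronwall
    exact (hφg t ht).trans hgronwall
  · have hs' := Ico_subset_Icc_self hs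
    rw [add_zero, hψφ hs']
    exact mul_le_mul_of_nonneg_left (hφg s hs') hC

theorem forall_mem_Icc_of_forall_mem_isClosed {X : Type*} [TopologicalSpace X] {x : ℝ → X} {T : ℝ}
    {O L : Set X} (hx : ContinuousOn x (Icc 0 T)) (hO : IsOpen O) (hL : IsClosed L) (hLO : L ⊆ O)
    (h0 : x 0 ∈ O) (hstep : ∀ t ∈ Icc 0 T, (∀ s ∈ Icc 0 t, x s ∈ O) → x t ∈ L) :
    ∀ t ∈ Icc 0 T, x t ∈ O := by
  by_contra! hne
  -- Consider the first exit time `t₀` from `O`.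
  have hcpt : IsCompact (Icc 0 T ∩ x ⁻¹' Oᶜ) :=
    isCompact_Icc.of_isClosed_subset (hx.preimage_isClosed_of_isClosed isClosed_Icc
      hO.isClosed_compl) inter_subset_left
  obtain ⟨t₀, ⟨ht₀, hxt₀⟩, hleast⟩ := hcpt.exists_isLeast hne
  have hpos : 0 < t₀ := lt_of_le_of_ne ht₀.1 fun h => hxt₀ (h ▸ h0)
  have hbefore : MapsTo x (Ico 0 t₀) L := fun t ht =>
    hstep t ⟨ht.1, ht.2.le.trans ht₀.2⟩ fun s hs => by
      by_contra hsO
      exact (hleast ⟨⟨hs.1, (hs.2.trans ht.2.le).trans ht₀.2⟩, hsO⟩).not_gt (hs.2.trans_lt ht.2)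
  have hcont : ContinuousOn x (closure (Ico 0 t₀)) := by
    rw [closure_Ico hpos.ne]
    exact hx.mono (Icc_subset_Icc_right ht₀.2)
  refine hxt₀ (hLO (hL.closure_eq ▸ hbefore.closure_of_continuousOn hcont ?_))
  rw [closure_Ico hpos.ne]
  exact right_mem_Icc.2 hpos.le

variable {E A : Type*} [NormedAddCommGroup E] [NormedSpace ℝ E] {f : E → A → E} {O K S : Set E}
  {p : E} {u : ℝ → A} {x : ℝ → E} {Y : E → ℝ} {C M T : ℝ}

theorem IsTrajectoryOn.absolutelyContinuousOnInterval_comp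
    (h : IsTrajectoryOn f S (Icc 0 T) p u x) (hM : ∀ z ∈ S, ∀ w, ‖f z w‖ ≤ M)
    (hY : ∀ z ∈ S, ContDiffAt ℝ 1 Y z) {t : ℝ} (ht : t ∈ Icc 0 T) :
    AbsolutelyContinuousOnInterval (fun s => Y (x s)) 0 t := by
  have hsub : Icc 0 t ⊆ Icc 0 T := Icc_subset_Icc_right ht.2
  have hxlip : LipschitzOnWith M.toNNReal x (Icc 0 t) :=
    .of_dist_le_mul fun r hr s hs => by
      rw [dist_eq_norm, Real.dist_eq]
      exact (h.norm_sub_le hM (hsub hs) (hsub hr)).trans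
        (mul_le_mul_of_nonneg_right (Real.le_coe_toNNReal M) (abs_nonneg _))
  have himage : IsCompact (x '' Icc 0 t) := isCompact_Icc.image_of_continuousOn hxlip.continuousOn
  obtain ⟨K, hYlip⟩ := LocallyLipschitzOn.exists_lipschitzOnWith_of_compact (f := Y) himage <| by
    rintro _ ⟨s, hs, rfl⟩
    obtain ⟨K, N, hN, hK⟩ := (hY _ (h s (hsub hs)).1).exists_lipschitzOnWith
    exact ⟨K, N, mem_nhdsWithin_of_mem_nhds hN, hK⟩
  refine LipschitzOnWith.absolutelyContinuousOnInterval (K := K * M.toNNReal) ?_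
  rw [uIcc_of_le ht.1]
  exact hYlip.comp hxlip (mapsTo_image _ _)

theorem IsTrajectoryOn.apply_le_mul_exp [CompleteSpace E] (h : IsTrajectoryOn f S (Icc 0 T) p u x)
    (hM : ∀ z ∈ S, ∀ w, ‖f z w‖ ≤ M) (hY : ∀ z ∈ S, ContDiffAt ℝ 1 Y z) (hC : 0 ≤ C)
    (hYf : ∀ z ∈ S, ∀ w, fderiv ℝ Y z (f z w) ≤ C * Y z) {t : ℝ} (ht : t ∈ Icc 0 T) :
    Y (x t) ≤ Y p * Real.exp (C * t) := by
  have hcont : ContinuousOn (fun s => Y (x s)) (Icc 0 T) := fun s hs =>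
    (hY _ (h s hs).1).continuousAt.comp_continuousWithinAt (h.continuousOn s hs)
  refine le_mul_exp_of_le_add_integral hC hcont (fun r hr => ?_) ht
  have hAC := h.absolutelyContinuousOnInterval_comp hM hY hr
  have hderiv : ∀ᵐ s, s ∈ Ioo 0 r → deriv (fun s => Y (x s)) s ≤ C * Y (x s) := by
    filter_upwards [h.ae_hasDerivAt] with s hs hsr
    have hsT : s ∈ Ioo 0 T := Ioo_subset_Ioo_right hr.2 hsr
    have hsS : x s ∈ S := (h s (Ioo_subset_Icc_self hsT)).1
    have hYs := ((hY _ hsS).differentiableAt one_ne_zero).hasFDerivAt.comp_hasDerivAt s (hs hsT)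
    exact hYs.deriv.trans_le (hYf _ hsS _)
  have hCY : IntervalIntegrable (fun s => C * Y (x s)) volume 0 r :=
    ((hcont.mono (Icc_subset_Icc_right hr.2)).const_mul C).intervalIntegrable_of_Icc hr.1
  calc Y (x r) = Y p + ∫ s in (0 : ℝ)..r, deriv (fun s => Y (x s)) s := by
        rw [hAC.integral_deriv_eq_sub, h.apply_zero ⟨le_rfl, hr.1.trans hr.2⟩,
          add_sub_cancel]
    _ ≤ Y p + ∫ s in (0 : ℝ)..r, C * Y (x s) := by
        refine add_le_add_right (intervalIntegral.integral_mono_ae_restrict hr.1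
          hAC.intervalIntegrable_deriv hCY ?_) _
        rw [← restrict_Ioo_eq_restrict_Icc]
        exact (ae_restrict_iff' measurableSet_Ioo).2 hderiv

/-- The cutoff makes the dynamics complete without changing it on `K`. -/
theorem exists_continuous_bounded_cutoff [LocallyCompactSpace E] [TopologicalSpace A]
    [CompactSpace A] (hO : IsOpen O) (hf : ContinuousOn (Function.uncurry f) (O ×ˢ univ))
    (hK : IsCompact K) (hKO : K ⊆ O) :
    ∃ χ : E → ℝ, (∀ z, χ z ∈ Icc 0 1) ∧ (∀ z ∈ K, χ z = 1) ∧
      Continuous (Function.uncurry fun z w => χ z • f z w) ∧ ∃ M, ∀ z w, ‖χ z • f z w‖ ≤ M := by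
  obtain ⟨χ, hχ1, hχc, hχO, hχ⟩ := exists_continuousMap_one_of_isCompact_subset_isOpen hK hO hKO
  let F : E × A → E := Function.uncurry fun z w => χ z • f z w
  have hFsupp : Function.support F ⊆ tsupport χ ×ˢ univ := fun r hr =>
    ⟨subset_tsupport _ fun h => hr (by simp [F, Function.uncurry, h]), mem_univ _⟩
  have hFts : tsupport F ⊆ tsupport χ ×ˢ univ :=
    closure_minimal hFsupp ((isClosed_tsupport χ).prod isClosed_univ)
  have hF : Continuous F := continuous_of_tsupport fun r hr =>
    (χ.continuous.comp continuous_fst).continuousAt.smul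
      (hf.continuousAt ((hO.prod isOpen_univ).mem_nhds (prod_mono_left hχO (hFts hr))))
  obtain ⟨M, hM⟩ := HasCompactSupport.exists_bound_of_continuous
    ((hχc.prod isCompact_univ).of_isClosed_subset (isClosed_tsupport F) hFts) hF
  exact ⟨χ, hχ, fun z hz => hχ1 hz, hF, M, fun z w => hM (z, w)⟩

variable [FiniteDimensional ℝ E] [MeasurableSpace E] [BorelSpace E] [TopologicalSpace A]
  [CompactSpace A] [MeasurableSpace A] [OpensMeasurableSpace A]

/-- The trajectories are those of the cut-off dynamics: a scaling by `χ ∈ [0, 1]` preserves the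
growth condition, so they never leave a sublevel set of `Y` on which `χ = 1`. -/
theorem exists_isTrajectoryOn_of_growth (hO : IsOpen O)
    (hf : ContinuousOn (Function.uncurry f) (O ×ˢ univ)) (hY : ContDiffOn ℝ 1 Y O)
    (hY0 : ∀ z ∈ O, 0 ≤ Y z) (hYproper : ∀ B, IsCompact (O ∩ Y ⁻¹' Icc 0 B)) (hC : 0 ≤ C)
    (hYf : ∀ z ∈ O, ∀ w, fderiv ℝ Y z (f z w) ≤ C * Y z) (hK : IsCompact K) (hKO : K ⊆ O)
    (hT : 0 ≤ T) :
    ∃ L, IsCompact L ∧ L ⊆ O ∧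
      ∀ p ∈ K, ∀ u : ℝ → A, Measurable u → ∃ x, IsTrajectoryOn f L (Icc 0 T) p u x := by
  obtain ⟨B, hB⟩ := hK.bddAbove_image (hY.continuousOn.mono hKO)
  have hYB (p) (hp : p ∈ K) : Y p ≤ B := hB (mem_image_of_mem Y hp)
  let L : Set E := O ∩ Y ⁻¹' Icc 0 (B * Real.exp (C * T))
  have hL : IsCompact L := hYproper _
  obtain ⟨χ, hχ, hχ1, hF, M, hM⟩ := exists_continuous_bounded_cutoff hO hf hL inter_subset_left
  have hYχ (z) (hz : z ∈ O) (w) : fderiv ℝ Y z (χ z • f z w) ≤ C * Y z :=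
    calc fderiv ℝ Y z (χ z • f z w) = χ z * fderiv ℝ Y z (f z w) := map_smul _ _ _
      _ ≤ χ z * (C * Y z) := mul_le_mul_of_nonneg_left (hYf z hz w) (hχ z).1
      _ ≤ C * Y z := mul_le_of_le_one_left (mul_nonneg hC (hY0 z hz)) (hχ z).2
  refine ⟨L, hL, inter_subset_left, fun p hp u hu => ?_⟩
  obtain ⟨x, hx⟩ := exists_isTrajectoryOn_of_bounded hF hM hu p hT
  have hconfined (t) (ht : t ∈ Icc 0 T) (hxO : ∀ s ∈ Icc 0 t, x s ∈ O) : x t ∈ L := by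
    have htt : t ∈ Icc 0 t := right_mem_Icc.2 ht.1
    have hgrow : Y (x t) ≤ Y p * Real.exp (C * t) :=
      (hx.mono (Icc_subset_Icc_right ht.2) hxO).apply_le_mul_exp (fun z _ => hM z)
        (fun z hz => hY.contDiffAt (hO.mem_nhds hz)) hC hYχ htt
    refine ⟨hxO t htt, hY0 _ (hxO t htt), hgrow.trans ?_⟩
    have hexp := Real.exp_le_exp.2 (mul_le_mul_of_nonneg_left ht.2 hC)
    exact mul_le_mul (hYB p hp) hexp (Real.exp_pos _).le ((hY0 p (hKO hp)).trans (hYB p hp))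
  have hxO : ∀ t ∈ Icc 0 T, x t ∈ O :=
    forall_mem_Icc_of_forall_mem_isClosed hx.continuousOn hO hL.isClosed inter_subset_left
      (hx.apply_zero (left_mem_Icc.2 hT) ▸ hKO hp) hconfined
  have hxL (t) (ht : t ∈ Icc 0 T) : x t ∈ L :=
    hconfined t ht fun s hs => hxO s (Icc_subset_Icc_right ht.2 hs)
  refine ⟨x, (hx.mono le_rfl hxL).congr_ae (ae_of_all _ fun s t ht hs => ?_)⟩
  rw [uIoc_of_le ht.1] at hs
  rw [hχ1 _ (hxL s ⟨hs.1.le, hs.2.trans ht.2⟩), one_smul]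

theorem exists_isTrajectoryOn_Icc_of_isCompact (hO : IsOpen O)
    (hf : ContinuousOn (Function.uncurry f) (O ×ˢ univ)) (hK : IsCompact K) (hKO : K ⊆ O) :
    ∃ δ > 0, ∀ p ∈ K, ∀ u : ℝ → A, Measurable u → ∃ x, IsTrajectoryOn f O (Icc 0 δ) p u x := by
  obtain ⟨r, hr, hrO⟩ := hK.exists_cthickening_subset_open hO hKO
  obtain ⟨χ, -, hχ1, hF, M, hM⟩ :=
    exists_continuous_bounded_cutoff hO hf (hK.cthickening (r := r)) hrO
  refine ⟨r / (|M| + 1), by positivity, fun p hp u hu => ?_⟩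
  obtain ⟨x, hx⟩ := exists_isTrajectoryOn_of_bounded hF hM hu p (T := r / (|M| + 1)) (by positivity)
  have h0 : (0 : ℝ) ∈ Icc 0 (r / (|M| + 1)) := ⟨le_rfl, by positivity⟩
  have hxr (t) (ht : t ∈ Icc 0 (r / (|M| + 1))) : x t ∈ Metric.cthickening r K := by
    refine Metric.mem_cthickening_of_dist_le _ p r K hp ?_
    calc dist (x t) p ≤ M * |t - 0| := by
          rw [dist_eq_norm, ← hx.apply_zero h0]
          exact hx.norm_sub_le (fun z _ => hM z) h0 ht
      _ ≤ (|M| + 1) * t := by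
          rw [sub_zero, abs_of_nonneg ht.1]
          exact mul_le_mul_of_nonneg_right ((le_abs_self M).trans (lt_add_one _).le) ht.1
      _ ≤ r := (le_div_iff₀' (by positivity)).1 ht.2
  refine ⟨x, (hx.mono le_rfl fun t ht => hrO (hxr t ht)).congr_ae (ae_of_all _ fun s t ht hs => ?_)⟩
  rw [uIoc_of_le ht.1] at hs
  rw [hχ1 _ (hxr s ⟨hs.1.le, hs.2.trans ht.2⟩), one_smul]

end Growth

section Dependence

variable {E A : Type*} [NormedAddCommGroup E] [NormedSpace ℝ E]
  {f : E → A → E} {S : Set E} {p q : E} {u : ℝ → A} {x y : ℝ → E} {C T t : ℝ}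

theorem IsTrajectoryOn.norm_sub_le_mul_exp (hx : IsTrajectoryOn f S (Icc 0 T) p u x)
    (hy : IsTrajectoryOn f S (Icc 0 T) q u y) (hC : 0 ≤ C)
    (hf : ∀ z ∈ S, ∀ z' ∈ S, ∀ w, ‖f z w - f z' w‖ ≤ C * ‖z - z'‖) (ht : t ∈ Icc 0 T) :
    ‖x t - y t‖ ≤ ‖p - q‖ * Real.exp (C * t) := by
  have hcont : ContinuousOn (fun s => ‖x s - y s‖) (Icc 0 T) :=
    (hx.continuousOn.sub hy.continuousOn).norm
  refine le_mul_exp_of_le_add_integral hC hcont (fun r hr => ?_) ht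
  obtain ⟨-, hxi, hxr⟩ := hx r hr
  obtain ⟨-, hyi, hyr⟩ := hy r hr
  have hsub : Icc 0 r ⊆ Icc 0 T := Icc_subset_Icc_right hr.2
  have hdiff : x r - y r = (p - q) + ∫ s in (0 : ℝ)..r, (f (x s) (u s) - f (y s) (u s)) := by
    rw [intervalIntegral.integral_sub hxi hyi, hxr, hyr]
    abel
  rw [hdiff]
  refine (norm_add_le _ _).trans (add_le_add_right ?_ _)
  refine intervalIntegral.norm_integral_le_of_norm_le hr.1 (ae_of_all _ fun s hs => ?_)
    ((continuousOn_const.mul (hcont.mono hsub)).intervalIntegrable_of_Icc hr.1)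
  have hsT := hsub (Ioc_subset_Icc_self hs)
  exact hf _ (hx s hsT).1 _ (hy s hsT).1 _

end Dependence

section Concatenation

variable {α E A : Type*}

/-- Follow `a` up to time `T`, then `b` with its clock started at `T`. -/
noncomputable def concatAt (T : ℝ) (a b : ℝ → α) : ℝ → α :=
  fun t => if t ≤ T then a t else b (t - T)

theorem concatAt_of_le {T t : ℝ} {a b : ℝ → α} (h : t ≤ T) : concatAt T a b t = a t :=
  if_pos h

theorem concatAt_of_lt {T t : ℝ} {a b : ℝ → α} (h : T < t) : concatAt T a b t = b (t - T) :=
  if_neg h.not_ge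

theorem concatAt_add {T t : ℝ} {a b : ℝ → α} (ht : 0 ≤ t) (hab : a T = b 0) :
    concatAt T a b (T + t) = b t := by
  rcases ht.eq_or_lt with rfl | ht
  · rw [add_zero, concatAt_of_le le_rfl, hab]
  · rw [concatAt_of_lt (lt_add_of_pos_right T ht), add_sub_cancel_left]

theorem measurable_concatAt [MeasurableSpace α] {a b : ℝ → α} (ha : Measurable a)
    (hb : Measurable b) (T : ℝ) : Measurable (concatAt T a b) :=
  Measurable.ite measurableSet_Iic ha (hb.comp (measurable_id.sub_const T))

theorem tendsto_concatAt {T : ℝ} {a b : ℝ → α} {l : Filter α} (hb : Tendsto b atTop l) :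
    Tendsto (concatAt T a b) atTop l := by
  refine (hb.comp (tendsto_atTop_add_const_right atTop (-T) tendsto_id)).congr' ?_
  filter_upwards [eventually_gt_atTop T] with t ht
  rw [concatAt_of_lt ht, sub_eq_add_neg, Function.comp_apply, id]

variable [NormedAddCommGroup E] [NormedSpace ℝ E] {f : E → A → E} {S S' : Set E} {I J : Set ℝ}
  {p q r : E} {u v : ℝ → A} {x y : ℝ → E} {T T' : ℝ}

theorem IsTrajectoryOn.comp_add (hx : IsTrajectoryOn f S (Ici 0) p u x) (hT : 0 ≤ T) :
    IsTrajectoryOn f S (Ici 0) (x T) (fun t => u (t + T)) fun t => x (t + T) := by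
  intro t (ht : 0 ≤ t)
  obtain ⟨hS, ht_int, hxt⟩ := hx (t + T) (add_nonneg ht hT)
  obtain ⟨-, hT_int, hxT⟩ := hx T hT
  have hint := hT_int.symm.trans ht_int
  refine ⟨hS, ?_, ?_⟩
  · simpa only [sub_self, add_sub_cancel_right] using hint.comp_add_right T
  · change x (t + T) = _
    rw [intervalIntegral.integral_comp_add_right (fun s => f (x s) (u s)) T, zero_add, hxt, hxT,
      ← intervalIntegral.integral_add_adjacent_intervals hT_int hint, add_assoc]

theorem IsTrajectoryOn.concat (hx : IsTrajectoryOn f S (Icc 0 T) p u x)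
    (hy : IsTrajectoryOn f S I (x T) v y) (hT : 0 ≤ T)
    (hJ : ∀ t ∈ J, 0 ≤ t ∧ (T < t → t - T ∈ I)) :
    IsTrajectoryOn f S J p (concatAt T u v) (concatAt T x y) := by
  set g := fun s => f (concatAt T x y s) (concatAt T u v s) with hg
  have hfst : IsTrajectoryOn (fun _ w => w) S (Icc 0 T) p g x := by
    refine hx.congr_ae (ae_of_all _ fun s t ht hs => ?_)
    rw [uIoc_of_le ht.1] at hs
    simp only [hg, concatAt_of_le (hs.2.trans ht.2)]
  intro t ht
  obtain ⟨h0, hI⟩ := hJ t ht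
  rcases le_or_gt t T with htT | htT
  · rw [concatAt_of_le htT]
    exact hfst t ⟨h0, htT⟩
  rw [concatAt_of_lt htT]
  obtain ⟨hS, hy_int, hyt⟩ := hy (t - T) (hI htT)
  obtain ⟨-, hT_int, hxT⟩ := hfst T (right_mem_Icc.2 hT)
  have hsnd : EqOn (fun s => f (y (s - T)) (v (s - T))) g (uIoc T t) := by
    intro s hs
    rw [uIoc_of_le htT.le] at hs
    simp only [hg, concatAt_of_lt hs.1]
  have hint : IntervalIntegrable g volume T t := by
    have := hy_int.comp_sub_right T
    rw [zero_add, sub_add_cancel] at this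
    exact this.congr hsnd
  refine ⟨hS, hT_int.trans hint, ?_⟩
  rw [hyt, ← intervalIntegral.integral_add_adjacent_intervals hT_int hint, ← add_assoc, ← hxT,
    ← intervalIntegral.integral_congr_ae (ae_of_all _ hsnd),
    intervalIntegral.integral_comp_sub_right (fun s => f (y s) (v s)) T, sub_self]

variable [MeasurableSpace A]

/-- `q` is reached from `p` at time `T` along a trajectory in `S`. -/
def Reaches (f : E → A → E) (S : Set E) (T : ℝ) (p q : E) : Prop :=
  0 ≤ T ∧ ∃ u : ℝ → A, Measurable u ∧ ∃ x, IsTrajectoryOn f S (Icc 0 T) p u x ∧ x T = q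

theorem Reaches.mono (h : Reaches f S T p q) (hS : S ⊆ S') : Reaches f S' T p q := by
  obtain ⟨hT, u, hu, x, hx, hq⟩ := h
  exact ⟨hT, u, hu, x, hx.mono le_rfl fun t ht => hS (hx t ht).1, hq⟩

theorem Reaches.right_mem (h : Reaches f S T p q) : q ∈ S := by
  obtain ⟨hT, u, -, x, hx, rfl⟩ := h
  exact (hx T (right_mem_Icc.2 hT)).1

theorem IsTrajectoryOn.reaches (hx : IsTrajectoryOn f S (Icc 0 T) p u x) (hu : Measurable u)
    {t : ℝ} (ht : t ∈ Icc 0 T) : Reaches f S t p (x t) := by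
  have hsub : Icc 0 t ⊆ Icc 0 T := Icc_subset_Icc_right ht.2
  exact ⟨ht.1, u, hu, x, hx.mono hsub fun s hs => (hx s (hsub hs)).1, rfl⟩

theorem Reaches.refl [Nonempty A] (hp : p ∈ S) : Reaches f S 0 p p := by
  inhabit A
  refine ⟨le_rfl, fun _ => default, measurable_const, fun _ => p, fun t ht => ?_, rfl⟩
  obtain rfl : t = 0 := le_antisymm ht.2 ht.1
  exact ⟨hp, .refl, by rw [intervalIntegral.integral_same, add_zero]⟩

theorem Reaches.trans (h : Reaches f S T p q) (h' : Reaches f S T' q r) :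
    Reaches f S (T + T') p r := by
  obtain ⟨hT, u, hu, x, hx, rfl⟩ := h
  obtain ⟨hT', v, hv, y, hy, rfl⟩ := h'
  refine ⟨add_nonneg hT hT', _, measurable_concatAt hu hv T, _, hx.concat hy hT fun t ht =>
    ⟨ht.1, fun h => ⟨sub_nonneg.2 h.le, sub_le_iff_le_add'.2 ht.2⟩⟩, ?_⟩
  exact concatAt_add hT' (hy.apply_zero (left_mem_Icc.2 hT')).symm

/-- Some trajectory in `S` from `p` exists for all positive times and converges to the origin. -/
def IsNullControllable (f : E → A → E) (S : Set E) (p : E) : Prop :=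
  ∃ u : ℝ → A, Measurable u ∧ ∃ x, IsTrajectoryOn f S (Ici 0) p u x ∧ Tendsto x atTop (𝓝 0)

theorem IsTrajectoryOn.isNullControllable (hx : IsTrajectoryOn f S (Ici 0) p u x)
    (hu : Measurable u) (hlim : Tendsto x atTop (𝓝 0)) {t : ℝ} (ht : 0 ≤ t) :
    IsNullControllable f S (x t) :=
  ⟨_, hu.comp (measurable_id.add_const t), _, hx.comp_add ht,
    hlim.comp (tendsto_atTop_add_const_right atTop t tendsto_id)⟩

theorem IsNullControllable.of_reaches (h : Reaches f S T p q) (hq : IsNullControllable f S q) :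
    IsNullControllable f S p := by
  obtain ⟨hT, u, hu, x, hx, rfl⟩ := h
  obtain ⟨v, hv, y, hy, hlim⟩ := hq
  exact ⟨_, measurable_concatAt hu hv T, _, hx.concat hy hT fun t ht =>
    ⟨ht, fun h => sub_nonneg.2 h.le⟩, tendsto_concatAt hlim⟩

end Concatenation

section InfiniteConcatenation

variable {α E A : Type*} {τ : ℕ → ℝ}

/-- The concatenation of `a 0, …, a k`, where `a j` is followed for a time `τ j`. -/
noncomputable def iterConcat : ℕ → (ℕ → ℝ) → (ℕ → ℝ → α) → ℝ → α
  | 0, _, a => a 0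
  | k + 1, τ, a => concatAt (τ 0) (a 0) (iterConcat k (fun j => τ (j + 1)) fun j => a (j + 1))

/-- The concatenation of all `a j`, where `a j` is followed for a time `τ j`. If all `τ j` are at
least `1`, then finitely many arcs, as many as the cut-off below provides, cover `[0, t]`. -/
noncomputable def infConcat (τ : ℕ → ℝ) (a : ℕ → ℝ → α) (t : ℝ) : α :=
  iterConcat ⌊t⌋₊ τ a t

theorem iterConcat_succ (k : ℕ) (τ : ℕ → ℝ) (a : ℕ → ℝ → α) :
    iterConcat (k + 1) τ a =
      concatAt (τ 0) (a 0) (iterConcat k (fun j => τ (j + 1)) fun j => a (j + 1)) :=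
  rfl

theorem iterConcat_succ_apply (hτ : ∀ j, 1 ≤ τ j) (a : ℕ → ℝ → α) {k : ℕ} {t : ℝ}
    (ht : t ≤ k + 1) : iterConcat (k + 1) τ a t = iterConcat k τ a t := by
  induction k generalizing τ a t with
  | zero =>
    rw [Nat.cast_zero, zero_add] at ht
    rw [iterConcat_succ, concatAt_of_le (ht.trans (hτ 0)), iterConcat]
  | succ k ih =>
    rw [iterConcat_succ (k + 1), iterConcat_succ k τ]
    rcases le_or_gt t (τ 0) with h | h
    · rw [concatAt_of_le h, concatAt_of_le h]
    · rw [concatAt_of_lt h, concatAt_of_lt h]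
      refine ih (fun j => hτ (j + 1)) _ ?_
      push_cast at ht
      linarith [hτ 0]

theorem iterConcat_eq_infConcat (hτ : ∀ j, 1 ≤ τ j) (a : ℕ → ℝ → α) {k : ℕ} {t : ℝ}
    (hk : ⌊t⌋₊ ≤ k) : iterConcat k τ a t = infConcat τ a t := by
  induction k, hk using Nat.le_induction with
  | base => rfl
  | succ k hk ih =>
    have htk : t ≤ k + 1 :=
      (Nat.lt_floor_add_one t).le.trans (add_le_add_left (Nat.cast_le.2 hk) 1)
    rw [iterConcat_succ_apply hτ a htk, ih]

theorem infConcat_eq_concatAt (hτ : ∀ j, 1 ≤ τ j) (a : ℕ → ℝ → α) :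
    infConcat τ a =
      concatAt (τ 0) (a 0) (infConcat (fun j => τ (j + 1)) fun j => a (j + 1)) := by
  funext t
  rw [← iterConcat_eq_infConcat hτ a (Nat.le_succ ⌊t⌋₊), iterConcat_succ]
  rcases le_or_gt t (τ 0) with h | h
  · rw [concatAt_of_le h, concatAt_of_le h]
  · rw [concatAt_of_lt h, concatAt_of_lt h]
    refine iterConcat_eq_infConcat (fun j => hτ (j + 1)) _ (Nat.floor_le_floor ?_)
    linarith [hτ 0]

theorem measurable_iterConcat [MeasurableSpace α] {a : ℕ → ℝ → α} (ha : ∀ j, Measurable (a j))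
    (k : ℕ) : Measurable (iterConcat k τ a) := by
  induction k generalizing τ a with
  | zero => exact ha 0
  | succ k ih => exact measurable_concatAt (ha 0) (ih fun j => ha (j + 1)) _

theorem measurable_infConcat [MeasurableSpace α] {a : ℕ → ℝ → α} (ha : ∀ j, Measurable (a j)) :
    Measurable (infConcat τ a) := by
  have hprod : Measurable fun z : ℕ × ℝ => iterConcat z.1 τ a z.2 :=
    measurable_from_prod_countable_right fun k => measurable_iterConcat ha k
  exact hprod.comp (Nat.measurable_floor.prodMk measurable_id)

variable [NormedAddCommGroup E] [NormedSpace ℝ E] {f : E → A → E} {p : ℕ → E}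
  {u : ℕ → ℝ → A} {x : ℕ → ℝ → E}

theorem isTrajectoryOn_infConcat {S : Set E} (hτ : ∀ j, 1 ≤ τ j)
    (hx : ∀ j, IsTrajectoryOn f S (Icc 0 (τ j)) (p j) (u j) (x j))
    (hxp : ∀ j, x j (τ j) = p (j + 1)) :
    IsTrajectoryOn f S (Ici 0) (p 0) (infConcat τ u) (infConcat τ x) := by
  suffices H : ∀ N : ℕ, IsTrajectoryOn f S (Icc 0 N) (p 0) (infConcat τ u) (infConcat τ x) from
    fun t ht => H ⌈t⌉₊ t ⟨ht, Nat.le_ceil t⟩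
  intro N
  have hτ0 : 0 ≤ τ 0 := zero_le_one.trans (hτ 0)
  induction N generalizing τ p u x with
  | zero =>
    rw [infConcat_eq_concatAt hτ, infConcat_eq_concatAt hτ]
    refine (hx 0).concat (I := ∅) (fun _ ht => absurd ht (notMem_empty _)) hτ0 fun t ht =>
      ⟨ht.1, fun h => absurd h (ht.2.trans ?_).not_gt⟩
    rwa [Nat.cast_zero]
  | succ N ih =>
    rw [infConcat_eq_concatAt hτ, infConcat_eq_concatAt hτ]
    have htail := ih (fun j => hτ (j + 1)) (fun j => hx (j + 1)) (fun j => hxp (j + 1))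
      (zero_le_one.trans (hτ 1))
    rw [zero_add, ← hxp 0] at htail
    refine (hx 0).concat htail hτ0 fun t ht => ⟨ht.1, fun h => ⟨sub_nonneg.2 h.le, ?_⟩⟩
    have := ht.2
    push_cast at this
    linarith [hτ 0]

theorem eventually_infConcat_mem {S : ℕ → Set E} (hS : Antitone S) (hτ : ∀ j, 1 ≤ τ j)
    (hx : ∀ j, IsTrajectoryOn f (S j) (Icc 0 (τ j)) (p j) (u j) (x j))
    (hxp : ∀ j, x j (τ j) = p (j + 1)) (k : ℕ) : ∀ᶠ t in atTop, infConcat τ x t ∈ S k := by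
  induction k generalizing τ p u x S with
  | zero =>
    filter_upwards [eventually_ge_atTop 0] with t ht
    exact (isTrajectoryOn_infConcat hτ (fun j => (hx j).mono le_rfl fun t ht =>
      hS (Nat.zero_le j) ((hx j) t ht).1) hxp t ht).1
  | succ k ih =>
    rw [infConcat_eq_concatAt hτ]
    refine tendsto_principal.1 (tendsto_concatAt (tendsto_principal.2 ?_))
    exact ih (S := fun j => S (j + 1)) (fun i j hij => hS (Nat.succ_le_succ hij))
      (fun j => hτ (j + 1)) (fun j => hx (j + 1)) fun j => hxp (j + 1)

theorem exists_isTrajectoryOn_of_reaches [MeasurableSpace A] {S : ℕ → Set E} (hS : Antitone S)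
    (hτ : ∀ j, 1 ≤ τ j) (h : ∀ j, Reaches f (S j) (τ j) (p j) (p (j + 1))) :
    ∃ u : ℝ → A, Measurable u ∧ ∃ x, IsTrajectoryOn f (S 0) (Ici 0) (p 0) u x ∧
      ∀ k, ∀ᶠ t in atTop, x t ∈ S k := by
  choose _ u hu x hx hxp using h
  exact ⟨infConcat τ u, measurable_infConcat hu, infConcat τ x,
    isTrajectoryOn_infConcat hτ (fun j => (hx j).mono le_rfl fun t ht =>
      hS (Nat.zero_le j) ((hx j) t ht).1) hxp, eventually_infConcat_mem hS hτ hx hxp⟩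

end InfiniteConcatenation

section ControlSystem

variable {n m : ℕ} {U : Set (EuclideanSpace ℝ (Fin m))} {G G₁ : Set (EuclideanSpace ℝ (Fin n))}
  {f : EuclideanSpace ℝ (Fin n) → EuclideanSpace ℝ (Fin m) → EuclideanSpace ℝ (Fin n)}
  {K O : Set (EuclideanSpace ℝ (Fin n))} {p q : EuclideanSpace ℝ (Fin n)} {T : ℝ}

/-- The dynamics `f` with controls in the subtype of `U`, so that the control constraint is
carried by the type and Borel controls `ℝ → U` are admissible. -/
def restrictControls (U : Set (EuclideanSpace ℝ (Fin m)))
    (f : EuclideanSpace ℝ (Fin n) → EuclideanSpace ℝ (Fin m) → EuclideanSpace ℝ (Fin n)) :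
    EuclideanSpace ℝ (Fin n) → U → EuclideanSpace ℝ (Fin n) :=
  fun z w => f z w

theorem coe_mem_admissibleControls (hU : IsCompact U) {u : ℝ → U} (hu : Measurable u) :
    (fun t => (u t : EuclideanSpace ℝ (Fin m))) ∈ AdmissibleControls U := by
  obtain ⟨M, hM⟩ := hU.isBounded.exists_norm_le
  exact ⟨fun T _ => memLp_top_of_bound hu.subtype_val.aestronglyMeasurable M
    (ae_of_all _ fun t => hM _ (u t).2), fun t _ => (u t).2⟩

theorem exists_measurable_ae_eq_of_mem_admissibleControls
    {u : ℝ → EuclideanSpace ℝ (Fin m)} (hu : u ∈ AdmissibleControls U) :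
    ∃ v : ℝ → U, Measurable v ∧ ∀ᵐ t, 0 ≤ t → u t = v t := by
  have hae : AEStronglyMeasurable u (volume.restrict (Ici 0)) := by
    have hcover : (⋃ k : ℕ, Icc (0 : ℝ) (k + 1)) = Ici 0 :=
      subset_antisymm (iUnion_subset fun _ => Icc_subset_Ici_self) fun t ht =>
        mem_iUnion.2 ⟨⌊t⌋₊, ht, (Nat.lt_floor_add_one t).le⟩
    rw [← hcover, aestronglyMeasurable_iUnion_iff]
    exact fun k => (hu.1 (k + 1) k.cast_add_one_pos).1
  have hmem : ∀ᵐ t ∂volume.restrict (Ici 0), u t ∈ U :=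
    (ae_restrict_iff' measurableSet_Ici).2 (ae_of_all _ hu.2)
  obtain ⟨v, hv, hvU, huv⟩ := hae.aemeasurable.exists_ae_eq_range_subset hmem ⟨u 0, hu.2 0 le_rfl⟩
  have hvmem : ∀ t, v t ∈ U := fun t => hvU (mem_range_self t)
  exact ⟨fun t => ⟨v t, hvmem t⟩, hv.subtype_mk, (ae_restrict_iff' measurableSet_Ici).1 huv⟩

theorem mem_nullControllabilityRegion_iff (hU : IsCompact U) :
    p ∈ nullControllabilityRegion U G f ↔ IsNullControllable (restrictControls U f) G p := by
  constructor
  · rintro ⟨-, u, hu, x, hx, hlim⟩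
    obtain ⟨v, hv, huv⟩ := exists_measurable_ae_eq_of_mem_admissibleControls hu
    have hx' : IsTrajectoryOn f G (Ici 0) p u x := fun t ht => hx t ht (EReal.coe_lt_top t)
    refine ⟨v, hv, x, hx'.congr_ae ?_, tendsto_zero_iff_norm_tendsto_zero.2 hlim⟩
    filter_upwards [huv] with s hs t ht hst
    rw [uIoc_of_le ht] at hst
    rw [restrictControls, hs hst.1.le]
  · rintro ⟨u, hu, x, hx, hlim⟩
    refine ⟨?_, _, coe_mem_admissibleControls hU hu, x, fun t ht _ => hx t ht,
      tendsto_zero_iff_norm_tendsto_zero.1 hlim⟩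
    rw [← hx.apply_zero self_mem_Ici]
    exact (hx 0 self_mem_Ici).1

theorem SystemConditions.continuousOn_restrictControls (hsys : SystemConditions U G G₁ f) :
    ContinuousOn (Function.uncurry (restrictControls U f)) (G₁ ×ˢ univ) :=
  hsys.continuous_f.comp (f := fun z : EuclideanSpace ℝ (Fin n) × U => (z.1, z.2.1))
    (by fun_prop) fun z hz => ⟨hz.1, z.2.2⟩

theorem SystemConditions.compactSpace (hsys : SystemConditions U G G₁ f) : CompactSpace U :=
  isCompact_iff_compactSpace.1 hsys.compact_U

theorem SystemConditions.subset (hsys : SystemConditions U G G₁ f) : G ⊆ G₁ :=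
  subset_closure.trans hsys.closure_G_subset

theorem SystemConditions.exists_lipschitz (hsys : SystemConditions U G G₁ f) (hK : IsCompact K)
    (hKG : K ⊆ closure G) :
    ∃ C, 0 < C ∧ ∀ z ∈ K, ∀ z' ∈ K, ∀ w,
      ‖restrictControls U f z w - restrictControls U f z' w‖ ≤ C * ‖z - z'‖ := by
  obtain ⟨R, hR, hKR⟩ := hK.isBounded.subset_closedBall_lt 0 0
  obtain ⟨C, hC, hlip⟩ := hsys.lipschitz_f R hR
  exact ⟨C, hC, fun z hz z' hz' w => hlip z ⟨hKR hz, hKG hz⟩ z' ⟨hKR hz', hKG hz'⟩ w w.2⟩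

theorem SystemConditions.exists_isTrajectoryOn (hsys : SystemConditions U G G₁ f)
    (hK : IsCompact K) (hKG : K ⊆ G) (hT : 0 ≤ T) :
    ∃ L, IsCompact L ∧ L ⊆ closure G ∧ ∀ p ∈ K, ∀ u : ℝ → U, Measurable u →
      ∃ x, IsTrajectoryOn (restrictControls U f) (G ∩ L) (Icc 0 T) p u x := by
  have := hsys.compactSpace
  obtain ⟨Y, C, hC, hYd, hY0, hYp, hYf⟩ := hsys.growth
  -- Strong invariance speaks about half-open time intervals, hence the longer horizon.
  obtain ⟨L, hL, hLG₁, htraj⟩ := exists_isTrajectoryOn_of_growth hsys.open_G₁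
    hsys.continuousOn_restrictControls hYd hY0 (fun B => hYp _ isCompact_Icc) hC.le
    (fun z hz w => hYf z hz w w.2) hK (hKG.trans hsys.subset) (add_nonneg hT zero_le_one)
  refine ⟨L ∩ closure G, hL.inter_right isClosed_closure, inter_subset_right,
    fun p hp u hu => ?_⟩
  obtain ⟨x, hx⟩ := htraj p hp u hu
  have hx₁ : IsTrajectory f G₁ ((T + 1 : ℝ) : EReal) p (fun t => (u t : _)) x := fun t ht htT =>
    hx.mono le_rfl (fun s hs => hLG₁ (hx s hs).1) t ⟨ht, (EReal.coe_lt_coe_iff.1 htT).le⟩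
  have hxG : ∀ t ∈ Icc 0 T, x t ∈ G := fun t ht =>
    hsys.strongly_invariant _ (EReal.coe_pos.2 (by linarith)) p (hKG hp) _
      (coe_mem_admissibleControls hsys.compact_U hu) x hx₁ t ht.1
      (EReal.coe_lt_coe_iff.2 (by linarith [ht.2]))
  have hsub : Icc 0 T ⊆ Icc 0 (T + 1) := Icc_subset_Icc_right (by linarith)
  exact ⟨x, hx.mono hsub fun t ht =>
    ⟨hxG t ht, (hx t (hsub ht)).1, subset_closure (hxG t ht)⟩⟩

theorem SystemConditions.eventually_reaches (hsys : SystemConditions U G G₁ f) (hO : IsOpen O)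
    (hOG : O ⊆ G) (h : Reaches (restrictControls U f) O T p q) {N : Set (EuclideanSpace ℝ (Fin n))}
    (hN : N ∈ 𝓝 q) :
    ∀ᶠ p' in 𝓝 p, ∃ q' ∈ N, Reaches (restrictControls U f) O T p' q' := by
  obtain ⟨hT, u, hu, x, hx, rfl⟩ := h
  have hxK : IsCompact (x '' Icc 0 T) := isCompact_Icc.image_of_continuousOn hx.continuousOn
  have hxO : x '' Icc 0 T ⊆ O := image_subset_iff.2 fun t ht => (hx t ht).1
  obtain ⟨δ, hδ, hδO⟩ := hxK.exists_thickening_subset_open hO hxO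
  obtain ⟨ρ, hρ, hρN⟩ := Metric.mem_nhds_iff.1 hN
  have hpG : p ∈ G := by
    rw [← hx.apply_zero (left_mem_Icc.2 hT)]
    exact hOG (hx 0 (left_mem_Icc.2 hT)).1
  obtain ⟨r, hr, hrG⟩ := Metric.nhds_basis_closedBall.mem_iff.1 (hsys.open_G.mem_nhds hpG)
  obtain ⟨L, hL, hLG, htraj⟩ := hsys.exists_isTrajectoryOn (isCompact_closedBall p r) hrG hT
  obtain ⟨C, hC, hlip⟩ := hsys.exists_lipschitz (hL.union hxK)
    (union_subset hLG (hxO.trans (hOG.trans subset_closure)))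
  have hclose : ∀ᶠ p' in 𝓝 p, ‖p' - p‖ * Real.exp (C * T) < min δ ρ := by
    have : Tendsto (fun p' => ‖p' - p‖ * Real.exp (C * T)) (𝓝 p) (𝓝 0) := by
      simpa only [zero_mul] using (tendsto_norm_sub_self p).mul_const (Real.exp (C * T))
    exact this.eventually_lt_const (lt_min hδ hρ)
  filter_upwards [Metric.closedBall_mem_nhds p hr, hclose] with p' hp' hlt
  obtain ⟨y, hy⟩ := htraj p' hp' u hu
  have hxy : ∀ t ∈ Icc 0 T, dist (y t) (x t) < min δ ρ := fun t ht => by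
    rw [dist_eq_norm]
    refine ((hy.mono le_rfl fun t ht => Or.inl (hy t ht).1.2).norm_sub_le_mul_exp
      (hx.mono le_rfl fun t ht => Or.inr (mem_image_of_mem x ht)) hC.le hlip ht).trans_lt
        (hlt.trans_le' ?_)
    gcongr
    exact ht.2
  refine ⟨y T, hρN ((hxy T (right_mem_Icc.2 hT)).trans_le (min_le_right _ _)), hT, u, hu, y,
    hy.mono le_rfl fun t ht => hδO ?_, rfl⟩
  exact Metric.mem_thickening_iff.2
    ⟨x t, mem_image_of_mem x ht, (hxy t ht).trans_le (min_le_left _ _)⟩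

theorem SystemConditions.isOpen_nullControllabilityRegion (hsys : SystemConditions U G G₁ f)
    (h0 : nullControllabilityRegion U G f ∈ 𝓝 0) : IsOpen (nullControllabilityRegion U G f) := by
  refine isOpen_iff_mem_nhds.2 fun p hp => ?_
  obtain ⟨u, hu, x, hx, hlim⟩ := (mem_nullControllabilityRegion_iff hsys.compact_U).1 hp
  obtain ⟨T, hxT, hT⟩ := ((hlim.eventually (eventually_mem_nhds_iff.2 h0)).and
    (eventually_ge_atTop 0)).exists
  have hreach : Reaches (restrictControls U f) G T p (x T) :=
    ⟨hT, u, hu, x, hx.mono Icc_subset_Ici_self fun t ht => (hx t ht.1).1, rfl⟩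
  filter_upwards [hsys.eventually_reaches hsys.open_G le_rfl hreach hxT] with p' ⟨q', hq', hpq⟩
  rw [mem_nullControllabilityRegion_iff hsys.compact_U] at hq' ⊢
  exact .of_reaches hpq hq'

theorem SystemConditions.isConnected_nullControllabilityRegion (hsys : SystemConditions U G G₁ f)
    (h0 : nullControllabilityRegion U G f ∈ 𝓝 0) :
    IsConnected (nullControllabilityRegion U G f) := by
  obtain ⟨r, hr, hball⟩ := Metric.mem_nhds_iff.1 h0
  refine ⟨⟨0, hball (Metric.mem_ball_self hr)⟩, isPreconnected_of_forall 0 fun p hp => ?_⟩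
  obtain ⟨u, hu, x, hx, hlim⟩ := (mem_nullControllabilityRegion_iff hsys.compact_U).1 hp
  obtain ⟨T, hxT, hT⟩ := ((hlim.eventually (Metric.ball_mem_nhds 0 hr)).and
    (eventually_ge_atTop 0)).exists
  have hxI : ContinuousOn x (Icc 0 T) :=
    (hx.mono Icc_subset_Ici_self fun t ht => (hx t ht.1).1).continuousOn
  refine ⟨Metric.ball 0 r ∪ x '' Icc 0 T, union_subset hball (image_subset_iff.2 fun t ht => ?_),
    Or.inl (Metric.mem_ball_self hr),
    Or.inr ⟨0, left_mem_Icc.2 hT, hx.apply_zero self_mem_Ici⟩, ?_⟩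
  · exact (mem_nullControllabilityRegion_iff hsys.compact_U).2
      (hx.isNullControllable hu hlim ht.1)
  · exact (convex_ball 0 r).isPreconnected.union (x T) hxT
      (mem_image_of_mem x (right_mem_Icc.2 hT)) (isPreconnected_Icc.image x hxI)

end ControlSystem

section Descent

theorem IsTrajectoryOn.hasDerivWithinAt_zero {E A : Type*} [NormedAddCommGroup E]
    [NormedSpace ℝ E] [CompleteSpace E] {f : E → A → E} {S : Set E} {T : ℝ} {p : E} {w : A}
    {x : ℝ → E} (hx : IsTrajectoryOn f S (Icc 0 T) p (fun _ => w) x) (hT : 0 < T)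
    (hf : ContinuousOn (fun z => f z w) S) : HasDerivWithinAt x (f p w) (Ici 0) 0 := by
  have hg : ContinuousOn (fun t => f (x t) w) (Icc 0 T) :=
    hf.comp hx.continuousOn fun t ht => (hx t ht).1
  have h0 : (0 : ℝ) ∈ Icc 0 T := left_mem_Icc.2 hT.le
  have hIcc : 𝓝[>] (0 : ℝ) ≤ 𝓝[Icc 0 T] 0 := by
    rw [nhdsWithin_Icc_eq_nhdsGE hT]
    exact nhdsWithin_mono 0 Ioi_subset_Ici_self
  have hderiv : HasDerivWithinAt (fun t => ∫ s in (0 : ℝ)..t, f (x s) w) (f (x 0) w) (Ici 0) 0 :=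
    intervalIntegral.integral_hasDerivWithinAt_right (t := Ioi 0) .refl
      ((hg.stronglyMeasurableAtFilter_nhdsWithin measurableSet_Icc 0).filter_mono hIcc)
      ((hg 0 h0).mono_left hIcc)
  rw [hx.apply_zero h0] at hderiv
  refine (hderiv.const_add p).congr_of_eventuallyEq ?_ (hx 0 h0).2.2
  filter_upwards [Icc_mem_nhdsGE hT] with t ht
  exact (hx t ht).2.2

theorem frequently_lt_of_lowerDini_neg {n : ℕ} {V : EuclideanSpace ℝ (Fin n) → ℝ}
    {x : ℝ → EuclideanSpace ℝ (Fin n)} {v : EuclideanSpace ℝ (Fin n)} {L : NNReal}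
    {s : Set (EuclideanSpace ℝ (Fin n))} (hs : s ∈ 𝓝 (x 0)) (hL : LipschitzOnWith L V s)
    (hx : HasDerivWithinAt x v (Ici 0) 0) (hV : lowerDini V (x 0) v < 0) :
    ∃ᶠ h in 𝓝[>] (0 : ℝ), V (x h) < V (x 0) := by
  obtain ⟨r, hVr, hr⟩ := EReal.lt_iff_exists_real_btwn.1 hV
  rw [EReal.coe_neg'] at hr
  have hdini := frequently_lt_of_liminf_lt (by isBoundedDefault) hVr
  have hslope : Tendsto (slope x 0) (𝓝[>] 0) (𝓝 v) :=
    (hasDerivWithinAt_iff_tendsto_slope' self_notMem_Ioi).1 hx.Ioi_of_Ici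
  have hfst : Tendsto Prod.fst (𝓝[>] (0 : ℝ) ×ˢ 𝓝 v) (𝓝[>] 0) := tendsto_fst
  have hstep : Tendsto (fun z => x 0 + z.1 • z.2) (𝓝[>] (0 : ℝ) ×ˢ 𝓝 v) (𝓝 (x 0)) := by
    simpa only [zero_smul, add_zero] using
      ((hfst.mono_right nhdsWithin_le_nhds).smul tendsto_snd).const_add (x 0)
  have herror : Tendsto (fun z => L * ‖slope x 0 z.1 - z.2‖) (𝓝[>] (0 : ℝ) ×ˢ 𝓝 v) (𝓝 0) := by
    simpa only [Function.comp_apply, sub_self, norm_zero, mul_zero] using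
      (((hslope.comp hfst).sub tendsto_snd).norm.const_mul (L : ℝ))
  have hxs : ∀ᶠ h in 𝓝[>] (0 : ℝ), x h ∈ s :=
    (hx.continuousWithinAt.mono Ioi_subset_Ici_self).eventually hs
  refine hfst.frequently ((hdini.and_eventually ((hfst.eventually hxs).and
    ((hstep.eventually hs).and ((herror.eventually_lt_const (neg_pos.2 hr)).and
      (hfst.eventually eventually_mem_nhdsWithin))))).mono ?_)
  rintro ⟨h, w⟩ ⟨hquot, hxh, hws, herr, hh : 0 < h⟩
  have hxw : x h - (x 0 + h • w) = h • (slope x 0 h - w) := by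
    rw [slope_def_module, sub_zero, smul_sub, smul_inv_smul₀ hh.ne', sub_sub]
  have hlip := (le_abs_self _).trans (hL.dist_le_mul _ hxh _ hws)
  rw [dist_eq_norm, hxw, norm_smul, Real.norm_of_nonneg hh.le] at hlip
  rw [EReal.coe_lt_coe_iff, div_lt_iff₀ hh] at hquot
  linarith [mul_lt_mul_of_pos_left herr hh]

end Descent

theorem exists_seq_of_forall_exists {α : Type*} {P : ℕ → α → Prop} {R : ℕ → α → α → Prop} {a : α}
    (ha : P 0 a) (h : ∀ k b, P k b → ∃ b', P (k + 1) b' ∧ R k b b') :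
    ∃ s : ℕ → α, s 0 = a ∧ ∀ k, R k (s k) (s (k + 1)) := by
  choose g hgP hgR using h
  let s : ∀ k, {b // P k b} := fun k => k.rec ⟨a, ha⟩ fun k b => ⟨g k b b.2, hgP k b b.2⟩
  exact ⟨fun k => (s k).1, rfl, fun k => hgR k (s k).1 (s k).2⟩

section Lyapunov

variable {n m : ℕ} {U : Set (EuclideanSpace ℝ (Fin m))} {G G₁ Ω : Set (EuclideanSpace ℝ (Fin n))}
  {f : EuclideanSpace ℝ (Fin n) → EuclideanSpace ℝ (Fin m) → EuclideanSpace ℝ (Fin n)}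
  {V : EuclideanSpace ℝ (Fin n) → ℝ} {a c ε η : ℝ} {O : Set (EuclideanSpace ℝ (Fin n))}
  {p : EuclideanSpace ℝ (Fin n)}

theorem LocalCLFConditions.exists_lowerDini_neg (hV : LocalCLFConditions U G f Ω V c)
    (hp : p ∈ Ω) (hp0 : p ≠ 0) : ∃ w : U, lowerDini V p (restrictControls U f p w) < 0 := by
  obtain ⟨W, -, hWpos, hW⟩ := hV.decrease
  have hinf : (⨅ u ∈ U, lowerDini V p (f p u)) < 0 :=
    (hW p hp).trans_lt (EReal.coe_neg'.2 (neg_lt_zero.2 (hWpos.2 p hp hp0)))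
  obtain ⟨w, hw, hlt⟩ := by simpa only [iInf_lt_iff] using hinf
  exact ⟨⟨w, hw⟩, hlt⟩

theorem LocalCLFConditions.nonempty_controls (hV : LocalCLFConditions U G f Ω V c) :
    Nonempty U := by
  obtain ⟨W, -, -, hW⟩ := hV.decrease
  have hinf : (⨅ u ∈ U, lowerDini V 0 (f 0 u)) < ⊤ :=
    (hW 0 hV.zero_mem).trans_lt (EReal.coe_lt_top _)
  obtain ⟨w, hw, -⟩ := by simpa only [iInf_lt_iff] using hinf
  exact ⟨w, hw⟩

theorem LocalCLFConditions.sublevel_subset (hV : LocalCLFConditions U G f Ω V c) (hε : ε ≤ c) :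
    {x ∈ closure Ω | V x ≤ ε} ⊆ Ω := by
  obtain ⟨C₃, hC₃, h⟩ := hV.sublevel_add_ball
  intro x hx
  exact h ⟨x, ⟨hx.1, hx.2.trans hε⟩, 0, Metric.mem_ball_self hC₃, add_zero x⟩

theorem LocalCLFConditions.nonneg (hV : LocalCLFConditions U G f Ω V c) (hp : p ∈ closure Ω) :
    0 ≤ V p := by
  rcases eq_or_ne p 0 with rfl | h
  · exact hV.posDef_V.1.ge
  · exact (hV.posDef_V.2 p hp h).le

theorem LocalCLFConditions.isCompact_sublevel (hV : LocalCLFConditions U G f Ω V c) (ε : ℝ) :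
    IsCompact {x ∈ closure Ω | V x ≤ ε} := by
  have hIcc : {x ∈ closure Ω | V x ≤ ε} = closure Ω ∩ V ⁻¹' Icc 0 ε :=
    Set.ext fun x => and_congr_right fun hx => (and_iff_right (hV.nonneg hx)).symm
  exact hIcc ▸ hV.proper_V _ isCompact_Icc

theorem LocalCLFConditions.isOpen_lt (hV : LocalCLFConditions U G f Ω V c) (a : ℝ) :
    IsOpen {x ∈ Ω | V x < a} :=
  (hV.continuous_V.mono subset_closure).isOpen_inter_preimage hV.open_Ω isOpen_Iio

theorem LocalCLFConditions.lt_mem_nhds_zero (hV : LocalCLFConditions U G f Ω V c) (hη : 0 < η) :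
    {x ∈ Ω | V x < η} ∈ 𝓝 0 :=
  (hV.isOpen_lt η).mem_nhds ⟨hV.zero_mem, hV.posDef_V.1.trans_lt hη⟩

theorem LocalCLFConditions.tendsto_zero {α : Type*} {l : Filter α}
    {x : α → EuclideanSpace ℝ (Fin n)} (hV : LocalCLFConditions U G f Ω V c)
    (hx : ∀ η > 0, ∀ᶠ t in l, x t ∈ {x ∈ Ω | V x < η}) : Tendsto x l (𝓝 0) := by
  refine Metric.tendsto_nhds.2 fun r hr => ?_
  obtain ⟨ε, hεr, hε⟩ := ((hV.sublevel_shrink.eventually_lt_const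
    (ENNReal.ofReal_pos.2 hr)).and eventually_mem_nhdsWithin).exists
  filter_upwards [hx ε hε] with t ht
  have hlt : ‖x t‖ₑ < ENNReal.ofReal r :=
    (le_iSup₂ (f := fun y (_ : y ∈ {x ∈ closure Ω | V x ≤ ε}) => ‖y‖ₑ) (x t)
      ⟨subset_closure ht.1, ht.2.le⟩).trans_lt hεr
  rwa [← ofReal_norm, ENNReal.ofReal_lt_ofReal_iff hr, ← dist_zero_right] at hlt

theorem SystemConditions.exists_isTrajectoryOn_Icc (hsys : SystemConditions U G G₁ f)
    (hO : IsOpen O) (hOG : O ⊆ G) {K : Set (EuclideanSpace ℝ (Fin n))} (hK : IsCompact K)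
    (hKO : K ⊆ O) : ∃ δ > 0, ∀ p ∈ K, ∀ u : ℝ → U, Measurable u →
      ∃ x, IsTrajectoryOn (restrictControls U f) O (Icc 0 δ) p u x := by
  have := hsys.compactSpace
  exact exists_isTrajectoryOn_Icc_of_isCompact hO
    (hsys.continuousOn_restrictControls.mono (prod_mono (hOG.trans hsys.subset) le_rfl)) hK hKO

theorem LocalCLFConditions.exists_reaches_lt (hsys : SystemConditions U G G₁ f)
    (hV : LocalCLFConditions U G f Ω V c) (hO : IsOpen O) (hOΩ : O ⊆ Ω) (hp : p ∈ O)
    (hp0 : p ≠ 0) : ∃ T q, V q < V p ∧ Reaches (restrictControls U f) O T p q := by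
  obtain ⟨w, hw⟩ := hV.exists_lowerDini_neg (hOΩ hp) hp0
  obtain ⟨L, s, hs, hL⟩ := hV.locallyLipschitz_V (hOΩ hp)
  rw [hV.open_Ω.nhdsWithin_eq (hOΩ hp)] at hs
  have hOG := hOΩ.trans hV.Ω_subset
  obtain ⟨δ, hδ, htraj⟩ := hsys.exists_isTrajectoryOn_Icc hO hOG isCompact_singleton
    (singleton_subset_iff.2 hp)
  obtain ⟨x, hx⟩ := htraj p rfl (fun _ => w) measurable_const
  obtain rfl := hx.apply_zero (left_mem_Icc.2 hδ.le)
  have hcont : ContinuousOn (fun z => restrictControls U f z w) O :=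
    hsys.continuousOn_restrictControls.comp (f := fun z => (z, w)) (by fun_prop) fun z hz =>
      ⟨hsys.subset (hOG hz), mem_univ w⟩
  obtain ⟨h, hlt, hh⟩ := ((frequently_lt_of_lowerDini_neg hs hL
    (hx.hasDerivWithinAt_zero hδ hcont) hw).and_eventually (Ioo_mem_nhdsGT hδ)).exists
  exact ⟨h, x h, hlt, hx.reaches measurable_const (Ioo_subset_Icc_self hh)⟩

/-- The infimum of `V` over the points reached from `p` is attained in the limit, and it can only
be attained at the origin: elsewhere `V` could be decreased further, by
`LocalCLFConditions.exists_reaches_lt`, also from all nearby points. -/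
theorem LocalCLFConditions.exists_reaches_small (hsys : SystemConditions U G G₁ f)
    (hV : LocalCLFConditions U G f Ω V c) (hp : p ∈ Ω) (hpc : V p ≤ c) (hpa : V p < a)
    (hη : 0 < η) :
    ∃ q ∈ Ω, V q < η ∧ ∃ T, Reaches (restrictControls U f) {x ∈ Ω | V x < a} T p q := by
  have := hV.nonempty_controls
  set S := {q | V q ≤ V p ∧ ∃ T, Reaches (restrictControls U f) {x ∈ Ω | V x < a} T p q}
  have hpS : p ∈ S := ⟨le_rfl, 0, .refl ⟨hp, hpa⟩⟩
  have hSsub : closure S ⊆ {x ∈ closure Ω | V x ≤ V p} :=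
    closure_minimal (fun q ⟨hq, T, hpq⟩ => ⟨subset_closure hpq.right_mem.1, hq⟩)
      (hV.isCompact_sublevel _).isClosed
  obtain ⟨q, hqS, hqmin⟩ := ((hV.isCompact_sublevel _).of_isClosed_subset isClosed_closure
    hSsub).exists_isMinOn ⟨p, subset_closure hpS⟩
      (hV.continuous_V.mono (hSsub.trans (sep_subset _ _)))
  have hq0 : q = 0 := by
    by_contra hq0
    have hqO : q ∈ {x ∈ Ω | V x < a} :=
      ⟨hV.sublevel_subset hpc (hSsub hqS), (hSsub hqS).2.trans_lt hpa⟩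
    obtain ⟨T, q', hq', hqq'⟩ := hV.exists_reaches_lt hsys (hV.isOpen_lt a) (sep_subset _ _) hqO hq0
    obtain ⟨r, ⟨-, T', hpr⟩, r', hr', hrr'⟩ := ((mem_closure_iff_frequently.1 hqS).and_eventually
      (hsys.eventually_reaches (hV.isOpen_lt a) ((sep_subset _ _).trans hV.Ω_subset) hqq'
        ((hV.isOpen_lt (V q)).mem_nhds ⟨hqq'.right_mem.1, hq'⟩))).exists
    have hr'S : r' ∈ S := ⟨hr'.2.le.trans (hSsub hqS).2, _, hpr.trans hrr'⟩
    exact (hqmin (subset_closure hr'S)).not_gt hr'.2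
  rw [hq0] at hqS
  obtain ⟨r, ⟨-, hpr⟩, hr⟩ := ((mem_closure_iff_frequently.1 hqS).and_eventually
    (hV.lt_mem_nhds_zero hη)).exists
  exact ⟨r, hr.1, hr.2, hpr⟩

theorem LocalCLFConditions.exists_reaches_half (hsys : SystemConditions U G G₁ f)
    (hV : LocalCLFConditions U G f Ω V c) (hε : 0 < ε) (hεc : ε ≤ c) (hp : p ∈ Ω)
    (hpε : V p ≤ ε) :
    ∃ q ∈ Ω, V q ≤ ε / 2 ∧ ∃ T, 1 ≤ T ∧
      Reaches (restrictControls U f) {x ∈ Ω | V x < 2 * ε} T p q := by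
  have hdescend {q} (hq : q ∈ Ω) (hqε : V q ≤ ε) := hV.exists_reaches_small (a := 2 * ε) hsys hq
    (hqε.trans hεc) (hqε.trans_lt (by linarith)) (half_pos hε)
  have hhalf : {x ∈ closure Ω | V x ≤ ε / 2} ⊆ {x ∈ Ω | V x < ε} := fun x hx =>
    ⟨hV.sublevel_subset (by linarith) hx, hx.2.trans_lt (half_lt_self hε)⟩
  obtain ⟨δ, hδ, htraj⟩ := hsys.exists_isTrajectoryOn_Icc (hV.isOpen_lt ε)
    ((sep_subset _ _).trans hV.Ω_subset) (hV.isCompact_sublevel (ε / 2)) hhalf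
  obtain ⟨w⟩ := hV.nonempty_controls
  have hiter (N : ℕ) : ∃ q ∈ Ω, V q ≤ ε / 2 ∧ ∃ T, N * δ ≤ T ∧
      Reaches (restrictControls U f) {x ∈ Ω | V x < 2 * ε} T p q := by
    induction N with
    | zero =>
      obtain ⟨q, hq, hqε, T, hpq⟩ := hdescend hp hpε
      exact ⟨q, hq, hqε.le, T, by simpa only [Nat.cast_zero, zero_mul] using hpq.1, hpq⟩
    | succ N ih =>
      obtain ⟨q, hq, hqε, T, hT, hpq⟩ := ih
      obtain ⟨x, hx⟩ := htraj q ⟨subset_closure hq, hqε⟩ (fun _ => w) measurable_const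
      have hqx := hx.reaches measurable_const (right_mem_Icc.2 hδ.le)
      obtain ⟨r, hr, hrε, T', hxr⟩ := hdescend hqx.right_mem.1 hqx.right_mem.2.le
      have hqx' := hqx.mono (S' := {x ∈ Ω | V x < 2 * ε}) fun y hy =>
        ⟨hy.1, hy.2.trans (by linarith)⟩
      refine ⟨r, hr, hrε.le, T + δ + T', ?_, (hpq.trans hqx').trans hxr⟩
      push_cast
      linarith [hxr.1]
  obtain ⟨N, hN⟩ := exists_nat_ge (1 / δ)
  obtain ⟨q, hq, hqε, T, hT, hpq⟩ := hiter N
  exact ⟨q, hq, hqε, T, ((div_le_iff₀ hδ).1 hN).trans hT, hpq⟩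

theorem LocalCLFConditions.sublevel_subset_nullControllabilityRegion
    (hsys : SystemConditions U G G₁ f) (hV : LocalCLFConditions U G f Ω V c) :
    {x ∈ closure Ω | V x ≤ c} ⊆ nullControllabilityRegion U G f := by
  intro p hp
  set e : ℕ → ℝ := fun k => c * (1 / 2) ^ k with he
  have he0 (k : ℕ) : 0 < e k := mul_pos hV.c_pos (by positivity)
  have hhalf (k : ℕ) : e (k + 1) = e k / 2 := by simp only [he, pow_succ]; ring
  have hanti : Antitone e := antitone_nat_of_succ_le fun k => by
    rw [hhalf]
    exact half_le_self (he0 k).le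
  have he_zero : e 0 = c := by simp only [he, pow_zero, mul_one]
  have hstep (k : ℕ) (q) (hq : q ∈ Ω ∧ V q ≤ e k) : ∃ q', (q' ∈ Ω ∧ V q' ≤ e (k + 1)) ∧
      ∃ T, 1 ≤ T ∧ Reaches (restrictControls U f) {x ∈ Ω | V x < 2 * e k} T q q' := by
    obtain ⟨q', hq', hVq', hreach⟩ := hV.exists_reaches_half hsys (he0 k)
      ((hanti (Nat.zero_le k)).trans_eq he_zero) hq.1 hq.2
    exact ⟨q', ⟨hq', hVq'.trans_eq (hhalf k).symm⟩, hreach⟩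
  obtain ⟨s, rfl, hs⟩ := exists_seq_of_forall_exists (P := fun k q => q ∈ Ω ∧ V q ≤ e k)
    ⟨hV.sublevel_subset le_rfl hp, hp.2.trans_eq he_zero.symm⟩ hstep
  choose τ hτ hreach using hs
  have hS : Antitone fun k => {x ∈ Ω | V x < 2 * e k} := fun j k hjk y hy =>
    ⟨hy.1, hy.2.trans_le (by linarith [hanti hjk])⟩
  obtain ⟨u, hu, x, hx, hxS⟩ := exists_isTrajectoryOn_of_reaches hS hτ hreach
  rw [mem_nullControllabilityRegion_iff hsys.compact_U]
  refine ⟨u, hu, x, hx.mono le_rfl fun t ht => hV.Ω_subset (hx t ht).1.1,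
    hV.tendsto_zero fun η hη => ?_⟩
  obtain ⟨k, hk⟩ := exists_pow_lt_of_lt_one (div_pos hη (mul_pos two_pos hV.c_pos))
    one_half_lt_one
  rw [lt_div_iff₀' (mul_pos two_pos hV.c_pos), mul_assoc] at hk
  exact (hxS k).mono fun t ht => ⟨ht.1, ht.2.trans hk⟩

theorem LocalCLFConditions.nullControllabilityRegion_mem_nhds_zero
    (hsys : SystemConditions U G G₁ f) (hV : LocalCLFConditions U G f Ω V c) :
    nullControllabilityRegion U G f ∈ 𝓝 0 :=
  mem_of_superset (hV.lt_mem_nhds_zero hV.c_pos) fun _ hx =>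
    hV.sublevel_subset_nullControllabilityRegion hsys ⟨subset_closure hx.1, hx.2.le⟩

end Lyapunov

theorem proposition2p14_general {n m : ℕ} (U : Set (EuclideanSpace ℝ (Fin m)))
    (G G₁ : Set (EuclideanSpace ℝ (Fin n)))
    (f : EuclideanSpace ℝ (Fin n) → EuclideanSpace ℝ (Fin m) → EuclideanSpace ℝ (Fin n))
    (hsys : SystemConditions U G G₁ f)
    (Ω : Set (EuclideanSpace ℝ (Fin n))) (V : EuclideanSpace ℝ (Fin n) → ℝ) (c : ℝ)
    (hV : LocalCLFConditions U G f Ω V c) :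
    IsOpen (nullControllabilityRegion U G f) ∧
    IsConnected (nullControllabilityRegion U G f) ∧
    {x ∈ closure Ω | V x ≤ c} ⊆ nullControllabilityRegion U G f ∧
    ∀ x₀ ∈ nullControllabilityRegion U G f, ∃ u ∈ AdmissibleControls U,
      ∃ x : ℝ → EuclideanSpace ℝ (Fin n), IsTrajectory f G ⊤ x₀ u x ∧
        ∀ t : ℝ, 0 ≤ t → x t ∈ nullControllabilityRegion U G f := by
  have h0 := hV.nullControllabilityRegion_mem_nhds_zero hsys
  refine ⟨hsys.isOpen_nullControllabilityRegion h0, hsys.isConnected_nullControllabilityRegion h0,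
    hV.sublevel_subset_nullControllabilityRegion hsys, fun x₀ hx₀ => ?_⟩
  obtain ⟨u, hu, x, hx, hlim⟩ := (mem_nullControllabilityRegion_iff hsys.compact_U).1 hx₀
  exact ⟨_, coe_mem_admissibleControls hsys.compact_U hu, x, fun t ht _ => hx t ht, fun t ht =>
    (mem_nullControllabilityRegion_iff hsys.compact_U).2 (hx.isNullControllable hu hlim ht)⟩

theorem proposition2p14 {n m : ℕ} (U : Set (EuclideanSpace ℝ (Fin m)))
    (G G₁ : Set (EuclideanSpace ℝ (Fin n)))
    (f : EuclideanSpace ℝ (Fin n) → EuclideanSpace ℝ (Fin m) → EuclideanSpace ℝ (Fin n))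
    (hsys : SystemConditions U G G₁ f)
    (hconv : ∀ x ∈ closure G, Convex ℝ ((fun u => f x u) '' U))
    (Ω : Set (EuclideanSpace ℝ (Fin n))) (V : EuclideanSpace ℝ (Fin n) → ℝ) (c : ℝ)
    (hV : LocalCLFConditions U G f Ω V c) :
    IsOpen (nullControllabilityRegion U G f) ∧
    IsConnected (nullControllabilityRegion U G f) ∧
    {x ∈ closure Ω | V x ≤ c} ⊆ nullControllabilityRegion U G f ∧
    ∀ x₀ ∈ nullControllabilityRegion U G f, ∃ u ∈ AdmissibleControls U,
      ∃ x : ℝ → EuclideanSpace ℝ (Fin n), IsTrajectory f G ⊤ x₀ u x ∧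
        ∀ t : ℝ, 0 ≤ t → x t ∈ nullControllabilityRegion U G f :=
  proposition2p14_general U G G₁ f hsys Ω V c hV
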